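/- **Setting.** Let $\mathcal H$ be a discrete-time linear stochastic hybrid system with a finite nonempty set of modes $A$, hybrid states $S=A\times\mathbb R^m$, matrices $F(a)\in\mathbb R^{m\times m}$, $G(a)\in\mathbb R^{m\times r}$ and noise covariance $\mathrm{Cov}_w$, such that $G(a)\,\mathrm{Cov}_w\,G(a)^T$ is positive definite for every $a\in A$. Let $T(\cdot\mid x,a)$ be the law of $F(a)x+G(a)w$ with $w\sim\mathcal N(0,\mathrm{Cov}_w)$. A (measurable) switching strategy $\sigma_{\mathcal H}$ assigns a mode to every finite path; if it assigns $b$ to a path ending in $(a,x)$, then the next hybrid state is $(b,x')$ with $x'\sim T(\cdot\mid x,b)$. Let $X\subset\mathbb R^m$ be compact, and let $r_p\subseteq X$ ($p\in\Upsilon$, $\Upsilon$ finite) be closed regions of interest; the label of $(a,x)$ is $L(a,x)=\{p: x\in r_p\}$. Let $\varphi$ be a co-safe LTL or a bounded LTL formula over $\Upsilon$. A finite trace satisfies $\varphi$ if it is a good prefix, i.e. all its infinite continuations satisfy $\varphi$. Let $P(\varphi\mid s_0,X,\sigma_{\mathcal H})$ be the probability that the path from $s_0$ under $\sigma_{\mathcal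 H}$ has a finite initial segment $s_0\dots s_k$ that stays in $A\times X$ and whose trace $L(s_0)\dots L(s_k)$ satisfies $\varphi$. Let $\mathcal A_\varphi=(Z,2^\Upsilon,\tau,z_0,Z_{ac})$ be a finite deterministic automaton accepting exactly the good prefixes of $\varphi$. **Abstraction.** For every mode $a$ let $X$ be the union of finitely many full-dimensional convex polytopes (the cells $Q^a$) with pairwise intersections of Lebesgue measure zero. Assume that the discretization respects the regions of interest: in every mode each $r_p$ is a union of cells. Let $Q=\bar Q\cup\{q_u\}$ with $\bar Q=\bigsqcup_a Q^a$. The IMDP $\mathcal I$ has states $Q$, actions $A$, labels $L(q)=\{p: q\subseteq r_p\}$ for $q\in\bar Q$, $L(q_u)=\emptyset$, and interval bounds, for $q\in\bar Q$, $$\check P(q,a,q')=\min_{x\in q}T(q'\mid x,a),\quad \hat P(q,a,q')=\max_{x\in q}T(q'\mid x,a)\qquad (q'\in Q^a),$$ both $0$ for $q'\in Q^{a'}$ with $a'\ne a$, and $$\check P(q,a,q_u)=1-\max_{x\in q}T(X\mid x,a),\quad \hat P(q,a,q_u)=1-\min_{x\in q}T(X\mid x,a),$$ while $q_u$ is absorbing.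 The product $\mathcal I\times\mathcal A_\varphi$ has states $Q\times Z$; its bounds from $(q,z)$ to $(q',z')$ under $a$ are those of $\mathcal I$ from $q$ to $q'$ if $z'=\tau(z,L(q'))$, and $0$ otherwise; its accepting set is $\bar Q\times Z_{ac}$. Write $\Gamma_{s,a}$ for the set of feasible distributions of the product at state $s$ and action $a$. Let $\check p$ be the limit of the recursive evaluations, started from $0$, of $$\check p(s)=1\ \text{ if } s \text{ is accepting},\qquad \check p(s)=\max_{a\in A}\min_{\gamma\in\Gamma_{s,a}}\sum_{s'}\gamma(s')\check p(s')\ \text{ otherwise};$$ let $\sigma^*$ be a stationary strategy on the product that attains the maximum at every non-accepting state; and let $\hat p$ be the limit of the recursive evaluations, started from $0$, of $$\hat p(s)=1\ \text{ if } s \text{ is accepting},\qquad \hat p(s)=\max_{\gamma\in\Gamma_{s,\sigma^*(s)}}\sum_{s'}\gamma(s')\hat p(s')\ \text{ otherwise}.$$ For $q\in Q$ put $\check p_\varphi(q)=\check p(q,\tau(z_0,L(q)))$ and $\hat p_\varphi(q)=\hat p(q,\tau(z_0,L(q)))$. **Refinement.** Let $J:S\to Q$ be a measurable map that sends $(a,x)$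 to a cell of $Q^a$ containing $x$ if $x\in X$, and to $q_u$ otherwise. Refine $\sigma^*$ to the switching strategy $$\sigma^*_{\mathcal H}(s_0\dots s_k)=\sigma^*\big(J(s_k),z\big),$$ where $z$ is the state of $\mathcal A_\varphi$ after reading $L(J(s_0))\dots L(J(s_k))$. **Theorem.** For every initial state $s_0\in S$ with $L(s_0)=L(J(s_0))$, $$\check p_\varphi(J(s_0))\ \le\ P(\varphi\mid s_0,X,\sigma^*_{\mathcal H})\ \le\ \hat p_\varphi(J(s_0)).$$ In particular, for every mode $a$, every cell $q\in Q^a$ and every $x$ in the interior of $q$, $$\check p_\varphi(q)\ \le\ P(\varphi\mid (a,x),X,\sigma^*_{\mathcal H})\ \le\ \hat p_\varphi(q).$$ -/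

import Mathlib

open MeasureTheory ProbabilityTheory

/-! ### Temporal logic -/

/-- Syntax of co-safe LTL over the atomic propositions `Υ`. -/
inductive CsLTL (Υ : Type*) where
  | atom (p : Υ)
  | natom (p : Υ)
  | or (φ ψ : CsLTL Υ)
  | and (φ ψ : CsLTL Υ)
  | next (φ : CsLTL Υ)
  | until (φ ψ : CsLTL Υ)
  | eventually (φ : CsLTL Υ)

/-- Syntax of bounded LTL over the atomic propositions `Υ`. -/
inductive BLTL (Υ : Type*) where
  | atom (p : Υ)
  | not (φ : BLTL Υ)
  | or (φ ψ : BLTL Υ)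
  | next (φ : BLTL Υ)
  | until (k : ℕ) (φ ψ : BLTL Υ)
  | eventually (k : ℕ) (φ : BLTL Υ)
  | always (k : ℕ) (φ : BLTL Υ)

/-- Semantics of co-safe LTL over infinite traces. -/
def CsLTL.Sat {Υ : Type*} : CsLTL Υ → Stream' (Set Υ) → Prop
  | atom p, ξ => p ∈ ξ.get 0
  | natom p, ξ => p ∉ ξ.get 0
  | or φ ψ, ξ => φ.Sat ξ ∨ ψ.Sat ξ
  | and φ ψ, ξ => φ.Sat ξ ∧ ψ.Sat ξ
  | next φ, ξ => φ.Sat (ξ.drop 1)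
  | .until φ ψ, ξ => ∃ k, ψ.Sat (ξ.drop k) ∧ ∀ i < k, φ.Sat (ξ.drop i)
  | eventually φ, ξ => ∃ k, φ.Sat (ξ.drop k)

/-- Semantics of bounded LTL over infinite traces. -/
def BLTL.Sat {Υ : Type*} : BLTL Υ → Stream' (Set Υ) → Prop
  | atom p, ξ => p ∈ ξ.get 0
  | not φ, ξ => ¬ φ.Sat ξ
  | or φ ψ, ξ => φ.Sat ξ ∨ ψ.Sat ξ
  | next φ, ξ => φ.Sat (ξ.drop 1)
  | .until k φ ψ, ξ => ∃ j ≤ k, ψ.Sat (ξ.drop j) ∧ ∀ i < j, φ.Sat (ξ.drop i)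
  | eventually k φ, ξ => ∃ j ≤ k, φ.Sat (ξ.drop j)
  | always k φ, ξ => ∀ j ≤ k, φ.Sat (ξ.drop j)

/-- A specification: a co-safe LTL formula or a bounded LTL formula. -/
inductive Spec (Υ : Type*) where
  | cs (φ : CsLTL Υ)
  | bounded (φ : BLTL Υ)

def Spec.Sat {Υ : Type*} : Spec Υ → Stream' (Set Υ) → Prop
  | cs φ, ξ => φ.Sat ξ
  | bounded φ, ξ => φ.Sat ξ

/-- The finite trace `w` satisfies `φ`: it is a good prefix, that is, each of its infinite
continuations satisfies `φ`. -/
def Spec.GoodPrefix {Υ : Type*} (φ : Spec Υ) (w : List (Set Υ)) : Prop :=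
  ∀ η : Stream' (Set Υ), φ.Sat (w ++ₛ η)

/-! ### Linear stochastic hybrid systems -/

/-- A discrete-time linear stochastic hybrid system with modes `A`, continuous domain `ℝᵐ`,
`r`-dimensional noise and atomic propositions `Υ`. -/
structure SHS (A Υ : Type*) (m r : ℕ) where
  /-- drift terms -/
  F : A → Matrix (Fin m) (Fin m) ℝ
  /-- diffusion terms -/
  G : A → Matrix (Fin m) (Fin r) ℝ
  /-- covariance matrix of the Gaussian noise -/
  cov : Matrix (Fin r) (Fin r) ℝ
  cov_posSemidef : cov.PosSemidef
  /-- labelling of the hybrid states -/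
  label : A × EuclideanSpace ℝ (Fin m) → Set Υ

/-- A switching strategy: it assigns a mode to each finite path `s₀ … sₙ` of hybrid states
(measurably, so that the controlled process is defined). -/
structure SwitchingStrategy (A : Type*) [MeasurableSpace A] (m : ℕ) where
  mode : (n : ℕ) → (Finset.Iic n → A × EuclideanSpace ℝ (Fin m)) → A
  measurable_mode : ∀ n, Measurable (mode n)

namespace SHS

variable {A Υ : Type*} {m r : ℕ}

/-- The right-hand side `F(a) x + G(a) w` of the dynamics. -/
noncomputable def dynamics (H : SHS A Υ m r) (a : A) (x : EuclideanSpace ℝ (Fin m))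
    (w : EuclideanSpace ℝ (Fin r)) : EuclideanSpace ℝ (Fin m) :=
  Matrix.toEuclideanLin (H.F a) x + Matrix.toEuclideanLin (H.G a) w

theorem continuous_dynamics (H : SHS A Υ m r) (a : A) :
    Continuous (fun p : EuclideanSpace ℝ (Fin m) × EuclideanSpace ℝ (Fin r) =>
      H.dynamics a p.1 p.2) :=
  ((LinearMap.continuous_of_finiteDimensional _).comp continuous_fst).add
    ((LinearMap.continuous_of_finiteDimensional _).comp continuous_snd)

theorem measurable_dynamics_right (H : SHS A Υ m r) (p : A × EuclideanSpace ℝ (Fin m)) :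
    Measurable (H.dynamics p.1 p.2) :=
  ((H.continuous_dynamics p.1).comp (Continuous.prodMk_right p.2)).measurable

variable [MeasurableSpace A] [DiscreteMeasurableSpace A] [Countable A]

theorem measurable_uncurry_of_countable {E F E' : Type*} [MeasurableSpace E] [MeasurableSpace F]
    [MeasurableSpace E'] (f : A → E → F → E')
    (hf : ∀ a, Measurable fun p : E × F => f a p.1 p.2) :
    Measurable (fun p : (A × E) × F => f p.1.1 p.1.2 p.2) := by
  have h : Measurable (fun p : A × (E × F) => f p.1 p.2.1 p.2.2) :=
    measurable_from_prod_countable_right hf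
  exact h.comp (f := fun p : (A × E) × F => (p.1.1, (p.1.2, p.2))) (by fun_prop)

theorem measurable_dynamics (H : SHS A Υ m r) :
    Measurable (fun p : (A × EuclideanSpace ℝ (Fin m)) × EuclideanSpace ℝ (Fin r) =>
      H.dynamics p.1.1 p.1.2 p.2) :=
  measurable_uncurry_of_countable H.dynamics fun a => (H.continuous_dynamics a).measurable

/-- The transition kernel `T(· ∣ x, a)`: the law of `F(a) x + G(a) w` with `w ∼ N(0, Cov)`. -/
noncomputable def transition (H : SHS A Υ m r) :
    Kernel (A × EuclideanSpace ℝ (Fin m)) (EuclideanSpace ℝ (Fin m)) where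
  toFun p := (multivariateGaussian 0 H.cov).map (H.dynamics p.1 p.2)
  measurable' := by
    refine Measure.measurable_of_measurable_coe _ fun s hs => ?_
    simp_rw [Measure.map_apply (H.measurable_dynamics_right _) hs]
    exact measurable_measure_prodMk_left (H.measurable_dynamics hs)

instance (H : SHS A Υ m r) : IsMarkovKernel H.transition where
  isProbabilityMeasure p := Measure.isProbabilityMeasure_map
    (H.measurable_dynamics_right p).aemeasurable

/-- One step of the hybrid process: if mode `b` is chosen in the hybrid state `(a, x)`, then the
next hybrid state is `(b, x')` with `x' ∼ T(· ∣ x, b)`. -/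
noncomputable def move (H : SHS A Υ m r) :
    Kernel (A × (A × EuclideanSpace ℝ (Fin m))) (A × EuclideanSpace ℝ (Fin m)) :=
  Kernel.deterministic Prod.fst measurable_fst ×ₖ
    H.transition.comap (fun p => (p.1, p.2.2)) (by fun_prop)

instance (H : SHS A Υ m r) : IsMarkovKernel H.move := by
  unfold move; infer_instance

/-- The step kernels, given the past, of the process controlled by a switching strategy. -/
noncomputable def controlled (H : SHS A Υ m r) (σ : SwitchingStrategy A m) (n : ℕ) :
    Kernel (Finset.Iic n → A × EuclideanSpace ℝ (Fin m)) (A × EuclideanSpace ℝ (Fin m)) :=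
  H.move.comap (fun h => (σ.mode n h, h ⟨n, by simp⟩))
    ((σ.measurable_mode n).prodMk (measurable_pi_apply _))

instance (H : SHS A Υ m r) (σ : SwitchingStrategy A m) (n : ℕ) :
    IsMarkovKernel (H.controlled σ n) := by
  unfold controlled; infer_instance

/-- The law of the infinite sample path from the hybrid state `s₀` under the strategy `σ`
(Ionescu-Tulcea). -/
noncomputable def pathLaw (H : SHS A Υ m r) (σ : SwitchingStrategy A m)
    (s₀ : A × EuclideanSpace ℝ (Fin m)) : Measure (ℕ → A × EuclideanSpace ℝ (Fin m)) :=
  Kernel.traj (X := fun _ => A × EuclideanSpace ℝ (Fin m)) (H.controlled σ) 0 (fun _ => s₀)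


end SHS
namespace SHS

variable {A Υ : Type*} {m r : ℕ}

/-- The observation trace of the initial segment `s₀ … s_k` of a sample path. -/
def trace (H : SHS A Υ m r) (ω : ℕ → A × EuclideanSpace ℝ (Fin m)) (k : ℕ) : List (Set Υ) :=
  List.ofFn fun i : Fin (k + 1) => H.label (ω i)

/-- `P(φ ∣ s₀, X, σ)`: the probability that some finite initial segment of the sample path
remains in `X` and has a trace satisfying `φ`. -/
noncomputable def satProb [MeasurableSpace A] [DiscreteMeasurableSpace A] [Countable A]
    (H : SHS A Υ m r) (φ : Spec Υ) (s₀ : A × EuclideanSpace ℝ (Fin m))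
    (X : Set (EuclideanSpace ℝ (Fin m))) (σ : SwitchingStrategy A m) : ℝ :=
  (H.pathLaw σ s₀).real {ω | ∃ k, (∀ i ≤ k, (ω i).2 ∈ X) ∧ φ.GoodPrefix (H.trace ω k)}

end SHS

/-! ### Interval Markov decision processes -/

/-- The data of an interval MDP in which every action is available in every state. -/
structure IMDP (Q A : Type*) where
  /-- lower bounds of the transition probabilities -/
  lower : Q → A → Q → ℝ
  /-- upper bounds of the transition probabilities -/
  upper : Q → A → Q → ℝ

namespace IMDP

variable {Q A : Type*} [Fintype Q]

/-- The feasible distributions for the state `q` and the action `a`. -/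
def feasible (I : IMDP Q A) (q : Q) (a : A) : Set (Q → ℝ) :=
  {γ | γ ∈ stdSimplex ℝ Q ∧ ∀ q', I.lower q a q' ≤ γ q' ∧ γ q' ≤ I.upper q a q'}

/-- Minimal expectation of `v` over the feasible distributions. -/
noncomputable def minExp (I : IMDP Q A) (v : Q → ℝ) (q : Q) (a : A) : ℝ :=
  sInf ((fun γ : Q → ℝ => ∑ q', γ q' * v q') '' I.feasible q a)

/-- Maximal expectation of `v` over the feasible distributions. -/
noncomputable def maxExp (I : IMDP Q A) (v : Q → ℝ) (q : Q) (a : A) : ℝ :=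
  sSup ((fun γ : Q → ℝ => ∑ q', γ q' * v q') '' I.feasible q a)

open Classical in
/-- Recursive evaluation, from `0`, of the Bellman equation for the optimal lower bound on the
probability of reaching `T`. -/
noncomputable def lowerIter (I : IMDP Q A) (T : Set Q) : ℕ → Q → ℝ
  | 0, _ => 0
  | n + 1, q => if q ∈ T then 1 else ⨆ a, I.minExp (lowerIter I T n) q a

/-- The optimal lower bound: the limit of the (nondecreasing) recursive evaluations. -/
noncomputable def lowerValue (I : IMDP Q A) (T : Set Q) (q : Q) : ℝ :=
  ⨆ n, I.lowerIter T n q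

/-- The stationary strategy `σ` attains the maximum in the Bellman equation of the optimal
lower bound. -/
def IsOptimal (I : IMDP Q A) (T : Set Q) (σ : Q → A) : Prop :=
  ∀ q, q ∉ T → ∀ a, I.minExp (I.lowerValue T) q a ≤ I.minExp (I.lowerValue T) q (σ q)

open Classical in
/-- Recursive evaluation, from `0`, of the Bellman equation for the upper bound on the
probability of reaching `T` under the stationary strategy `σ`. -/
noncomputable def upperIter (I : IMDP Q A) (T : Set Q) (σ : Q → A) : ℕ → Q → ℝ
  | 0, _ => 0
  | n + 1, q => if q ∈ T then 1 else I.maxExp (upperIter I T σ n) q (σ q)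

/-- The upper bound under `σ`: the limit of the (nondecreasing) recursive evaluations. -/
noncomputable def upperValue (I : IMDP Q A) (T : Set Q) (σ : Q → A) (q : Q) : ℝ :=
  ⨆ n, I.upperIter T σ n q

end IMDP

namespace IMDP

variable {Q A Υ Z : Type*}

open Classical in
/-- The product of an interval MDP with labelling `L` and a DFA. -/
noncomputable def prod (I : IMDP Q A) (L : Q → Set Υ) (M : DFA (Set Υ) Z) : IMDP (Q × Z) A where
  lower p a p' := if p'.2 = M.step p.2 (L p'.1) then I.lower p.1 a p'.1 else 0
  upper p a p' := if p'.2 = M.step p.2 (L p'.1) then I.upper p.1 a p'.1 else 0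

end IMDP

/-- The history-dependent strategy on an interval MDP with labelling `L` that is given by a
stationary strategy on its product with a DFA. -/
def historyStrategy {Q A Υ Z : Type*} (L : Q → Set Υ) (M : DFA (Set Υ) Z) (σ : Q × Z → A)
    (n : ℕ) (path : Fin (n + 1) → Q) : A :=
  σ (path (Fin.last n), M.eval (List.ofFn fun i => L (path i)))

/-! ### Discretization and abstraction -/

/-- A full-dimensional convex polytope: the convex hull of finitely many points that affinely
span the space. -/
def IsPolytope {m : ℕ} (P : Set (EuclideanSpace ℝ (Fin m))) : Prop :=
  ∃ V : Finset (EuclideanSpace ℝ (Fin m)),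
    affineSpan ℝ (V : Set (EuclideanSpace ℝ (Fin m))) = ⊤ ∧
      P = convexHull ℝ (V : Set (EuclideanSpace ℝ (Fin m)))

/-- A discretization of `A × X`: for each mode, finitely many polytopes that cover `X` and
overlap only in null sets. -/
structure Discretization (A : Type*) {m : ℕ} (X : Set (EuclideanSpace ℝ (Fin m))) where
  /-- number of cells in each mode -/
  num : A → ℕ
  cell : (a : A) → Fin (num a) → Set (EuclideanSpace ℝ (Fin m))
  isPolytope : ∀ a i, IsPolytope (cell a i)
  iUnion_cell : ∀ a, ⋃ i, cell a i = X
  null_inter : ∀ a i j, i ≠ j → volume (cell a i ∩ cell a j) = 0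

namespace Discretization

variable {A Υ : Type*} {m r : ℕ} {X : Set (EuclideanSpace ℝ (Fin m))}

/-- The abstract states: the cells `some ⟨a, i⟩`, and `none` for the complement of `A × X`. -/
abbrev State (D : Discretization A X) : Type _ := Option (Σ a : A, Fin (D.num a))

/-- In each mode, each region of interest is a union of cells. -/
def Respects (D : Discretization A X) (R : Υ → Set (EuclideanSpace ℝ (Fin m))) : Prop :=
  ∀ p a, ∃ C : Set (Fin (D.num a)), ⋃ i ∈ C, D.cell a i = R p

/-- The labelling of the abstract states. -/
def label (D : Discretization A X) (R : Υ → Set (EuclideanSpace ℝ (Fin m))) :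
    D.State → Set Υ
  | some c => {p | D.cell c.1 c.2 ⊆ R p}
  | none => ∅

open Classical in
/-- The abstraction. Action `a` leads to a cell of mode `a` or out of `X`, so the bounds towards
cells of other modes are `0`. -/
noncomputable def abstraction [MeasurableSpace A] [DiscreteMeasurableSpace A] [Countable A]
    (D : Discretization A X) (H : SHS A Υ m r) : IMDP D.State A where
  lower
    | some c, a, some d =>
        if d.1 = a then ⨅ x : D.cell c.1 c.2, (H.transition (a, x)).real (D.cell d.1 d.2) else 0
    | some c, a, none => 1 - ⨆ x : D.cell c.1 c.2, (H.transition (a, x)).real X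
    | none, _, some _ => 0
    | none, _, none => 1
  upper
    | some c, a, some d =>
        if d.1 = a then ⨆ x : D.cell c.1 c.2, (H.transition (a, x)).real (D.cell d.1 d.2) else 0
    | some c, a, none => 1 - ⨅ x : D.cell c.1 c.2, (H.transition (a, x)).real X
    | none, _, some _ => 0
    | none, _, none => 1

/-- The accepting states of the product: a cell together with an accepting state of the DFA. -/
def accepting {Z : Type*} (D : Discretization A X) (M : DFA (Set Υ) Z) : Set (D.State × Z) :=
  {p | p.1 ≠ none ∧ p.2 ∈ M.accept}

/-- A map from hybrid states to abstract states: a point of `X` is sent to a cell of its mode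
that contains it (a choice on the common boundaries, made measurably). -/
structure Quantizer [MeasurableSpace A] (D : Discretization A X) where
  toFun : A × EuclideanSpace ℝ (Fin m) → D.State
  mem_cell : ∀ a x, x ∈ X → ∃ i, toFun (a, x) = some ⟨a, i⟩ ∧ x ∈ D.cell a i
  eq_none : ∀ a x, x ∉ X → toFun (a, x) = none
  measurableSet_fiber : ∀ q, MeasurableSet (toFun ⁻¹' {q})

/-- The switching strategy obtained by applying, to the image in the abstraction of each finite
path, the strategy given by a stationary strategy on the product. -/
def refine {Z : Type*} [Finite A] [MeasurableSpace A] {D : Discretization A X}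
    (J : D.Quantizer) (R : Υ → Set (EuclideanSpace ℝ (Fin m))) (M : DFA (Set Υ) Z)
    (σ : D.State × Z → A) : SwitchingStrategy A m where
  mode n h := historyStrategy (D.label R) M σ n
    fun i => J.toFun (h ⟨i, Finset.mem_Iic.2 (Nat.lt_succ_iff.1 i.2)⟩)
  measurable_mode n := by
    let _ : MeasurableSpace D.State := ⊤
    have hJ : Measurable J.toFun := measurable_to_countable' J.measurableSet_fiber
    have hpath : Measurable (fun (h : Finset.Iic n → A × EuclideanSpace ℝ (Fin m))
        (i : Fin (n + 1)) =>
        J.toFun (h ⟨i, Finset.mem_Iic.2 (Nat.lt_succ_iff.1 i.2)⟩)) :=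
      measurable_pi_lambda _ fun i => hJ.comp (measurable_pi_apply _)
    exact (Measurable.of_discrete (f := historyStrategy (D.label R) M σ n)).comp hpath

end Discretization

/-! ### Nondegenerate Gaussian measures -/

section Gaussian

open scoped MatrixOrder

/-! Follow the product of the abstract state and the automaton state along a random path, and freeze
it once it leaves `X` or accepts (`stoppedPath`). The proof is a martingale argument for this
finite-valued process.

The link with the IMDP is that, before stopping, the true law of the next product state is a
feasible distribution (`successorDist_mem_feasible`). Nondegenerate noise makes every transition law
absolutely continuous, so cell overlaps are never hit after time 0. Hence it does not matter how the
quantizer resolves boundaries, and almost surely the abstract trace is the concrete one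
(`satProb_eq`).

Upper bound: `upperValue` is superharmonic for every feasible choice and at least 1 on accepting
states. Its expectation along the stopped process does not increase and dominates the probability of
acceptance by time `k`.

Lower bound: `lowerValue` is subharmonic under the optimal strategy, at most 1, and 0 outside `X`.
Its initial value is therefore at most P(accepted by `k`) + P(not stopped by `k`)
(`lowerValue_le_add`). The last term must vanish: in a general IMDP, a strategy maximizing the
Bellman equation may cycle forever among states of positive value. Here the Gaussian noise pushes
the state out of the compact set `X` with probability at least `1 - ρ > 0` at each step, so the term
is at most `ρ ^ k`. This fails only in dimension 0, where the trace is deterministic and the bound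
is checked directly. -/

theorem MeasureTheory.Measure.AbsolutelyContinuous.pi_fin {n : ℕ} {μ ν : Measure ℝ}
    [SigmaFinite μ] [SigmaFinite ν] (h : μ ≪ ν) :
    Measure.pi (fun _ : Fin n => μ) ≪ Measure.pi (fun _ : Fin n => ν) := by
  induction n with
  | zero =>
    rw [Measure.pi_of_empty, Measure.pi_of_empty]
  | succ n ih =>
    have hμ := (measurePreserving_piFinSuccAbove (fun _ : Fin (n + 1) => μ) 0).symm
    have hν := (measurePreserving_piFinSuccAbove (fun _ : Fin (n + 1) => ν) 0).symm
    rw [← hμ.map_eq, ← hν.map_eq]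
    exact (h.prod ih).map hμ.measurable

theorem stdGaussian_absolutelyContinuous (m : ℕ) :
    stdGaussian (EuclideanSpace ℝ (Fin m)) ≪ volume := by
  rw [← map_pi_eq_stdGaussian, ← (PiLp.volume_preserving_toLp (Fin m)).map_eq, volume_pi]
  exact (Measure.AbsolutelyContinuous.pi_fin
    (gaussianReal_absolutelyContinuous 0 one_ne_zero)).map
      (PiLp.volume_preserving_toLp (Fin m)).measurable

/-- The measure is the image of the standard Gaussian under `x ↦ μ + √S x`, and `√S` is invertible
because its square `S` is; an invertible affine map pulls null sets back to null sets. -/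
theorem multivariateGaussian_absolutelyContinuous {m : ℕ} (μ : EuclideanSpace ℝ (Fin m))
    {S : Matrix (Fin m) (Fin m) ℝ} (hS : S.PosDef) : multivariateGaussian μ S ≪ volume := by
  have hdet : (Matrix.toEuclideanCLM (𝕜 := ℝ) (CFC.sqrt S)).det ≠ 0 := by
    have h1 : Matrix.toEuclideanCLM (𝕜 := ℝ) (CFC.sqrt S) *
        Matrix.toEuclideanCLM (𝕜 := ℝ) (CFC.sqrt S) = Matrix.toEuclideanCLM (𝕜 := ℝ) S := by
      rw [← map_mul, CFC.sqrt_mul_sqrt_self _ hS.posSemidef.nonneg]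
    have h2 : IsUnit (Matrix.toEuclideanCLM (𝕜 := ℝ) S) := hS.isUnit.map _
    rw [← h1] at h2
    have h3 : IsUnit (Matrix.toEuclideanCLM (𝕜 := ℝ) (CFC.sqrt S)) :=
      ((Commute.refl _).isUnit_mul_iff.1 h2).1
    obtain ⟨B, hB⟩ := h3.exists_right_inv
    have h4 := congrArg ContinuousLinearMap.toLinearMap hB
    have h5 := congrArg LinearMap.det h4
    rw [ContinuousLinearMap.toLinearMap_mul, map_mul] at h5
    refine left_ne_zero_of_mul_eq_one (h5.trans ?_)
    simp
  have hq := MeasureTheory.Measure.ContinuousLinearMap.quasiMeasurePreserving volume _ hdet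
  have hq' := (quasiMeasurePreserving_add_left (volume : Measure (EuclideanSpace ℝ (Fin m))) μ).comp
    hq
  exact ((stdGaussian_absolutelyContinuous m).map hq'.measurable).trans hq'.absolutelyContinuous

/-- Both sides are Gaussian, so it suffices to compare means and covariance forms; the covariance of
the image at `u, v` is that of `C` at `Gᵀu, Gᵀv`. -/
theorem map_multivariateGaussian_zero {m r : ℕ} {C : Matrix (Fin r) (Fin r) ℝ}
    (hC : C.PosSemidef) (G : Matrix (Fin m) (Fin r) ℝ) :
    (multivariateGaussian 0 C).map (Matrix.toEuclideanLin G) =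
      multivariateGaussian 0 (G * C * G.transpose) := by
  have hS : (G * C * G.transpose).PosSemidef := by
    simpa using hC.mul_mul_conjTranspose_same G
  let L := LinearMap.toContinuousLinearMap (Matrix.toEuclideanLin G)
  have hL : ∀ u : EuclideanSpace ℝ (Fin m), L.adjoint u = Matrix.toEuclideanLin G.transpose u := by
    intro u
    refine ext_inner_right ℝ fun v => ?_
    rw [ContinuousLinearMap.adjoint_inner_left]
    have := Matrix.toEuclideanLin_conjTranspose_eq_adjoint G
    rw [Matrix.conjTranspose_eq_transpose_of_trivial] at this
    rw [this, LinearMap.adjoint_inner_left]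
    rfl
  change (multivariateGaussian 0 C).map L = _
  apply IsGaussian.ext
  · simp only [id_eq, integral_id_multivariateGaussian]
    rw [ContinuousLinearMap.integral_id_map IsGaussian.integrable_id,
      integral_id_multivariateGaussian, map_zero]
  · ext u v
    rw [covarianceBilin_map IsGaussian.memLp_two_id, covarianceBilin_multivariateGaussian hC,
      covarianceBilin_multivariateGaussian hS, hL, hL]
    simp only [Matrix.toLpLin_apply, Matrix.mulVec_transpose, Matrix.dotProduct_mulVec,
      Matrix.vecMul_vecMul]
    rw [← Matrix.mulVec_transpose G v.ofLp, Matrix.dotProduct_mulVec, Matrix.vecMul_vecMul]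

/-- One coordinate suffices: it is a nondegenerate real Gaussian, so it exceeds `K` with positive
probability, and then so does the norm. -/
theorem multivariateGaussian_compl_ne_zero {m : ℕ} [NeZero m]
    {S : Matrix (Fin m) (Fin m) ℝ} (hS : S.PosDef) (K : ℝ) :
    multivariateGaussian 0 S (Metric.closedBall 0 K)ᶜ ≠ 0 := by
  intro h0
  have hp := measurePreserving_eval_multivariateGaussian (μ := 0) hS.posSemidef (i := (0 : Fin m))
  have hv : (S 0 0).toNNReal ≠ 0 := by
    simpa using hS.diag_pos (i := (0 : Fin m))
  have h1 : gaussianReal ((0 : EuclideanSpace ℝ (Fin m)) 0) (S 0 0).toNNReal (Set.Ioi K) = 0 := by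
    rw [← hp.measure_preimage measurableSet_Ioi.nullMeasurableSet]
    refine measure_mono_null (fun x hx => ?_) h0
    simp only [Set.mem_preimage, Set.mem_Ioi] at hx
    simp only [Set.mem_compl_iff, Metric.mem_closedBall, dist_zero_right, not_le]
    exact hx.trans_le ((le_abs_self _).trans (PiLp.norm_apply_le x 0))
  have h2 := gaussianReal_absolutelyContinuous' _ hv h1
  simp at h2

end Gaussian

/-! ### Transition laws: absolute continuity and escape from compact sets. -/

namespace SHS

variable {A Υ : Type*} {m r : ℕ} [MeasurableSpace A] [DiscreteMeasurableSpace A] [Countable A]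

theorem transition_apply (H : SHS A Υ m r) (a : A) (x : EuclideanSpace ℝ (Fin m)) :
    H.transition (a, x) = (multivariateGaussian 0 (H.G a * H.cov * (H.G a).transpose)).map
      (Matrix.toEuclideanLin (H.F a) x + ·) := by
  rw [← map_multivariateGaussian_zero H.cov_posSemidef, Measure.map_map (by fun_prop)
    (LinearMap.continuous_of_finiteDimensional _).measurable]
  rfl

theorem transition_absolutelyContinuous (H : SHS A Υ m r) {a : A}
    (hH : (H.G a * H.cov * (H.G a).transpose).PosDef) (x : EuclideanSpace ℝ (Fin m)) :
    H.transition (a, x) ≪ volume := by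
  rw [H.transition_apply]
  have hq := quasiMeasurePreserving_add_left (volume : Measure (EuclideanSpace ℝ (Fin m)))
    (Matrix.toEuclideanLin (H.F a) x)
  exact ((multivariateGaussian_absolutelyContinuous 0 hH).map hq.measurable).trans
    hq.absolutelyContinuous

/-- The process leaves a compact set with probability bounded away from `0`. -/
theorem exists_transition_le_of_isCompact [Finite A] [NeZero m] (H : SHS A Υ m r)
    (hH : ∀ a, (H.G a * H.cov * (H.G a).transpose).PosDef)
    {X : Set (EuclideanSpace ℝ (Fin m))} (hX : IsCompact X) :
    ∃ ρ : ℝ, 0 ≤ ρ ∧ ρ < 1 ∧ ∀ a, ∀ x ∈ X, (H.transition (a, x)).real X ≤ ρ := by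
  have key : ∀ a, ∃ ρ : ℝ, 0 ≤ ρ ∧ ρ < 1 ∧ ∀ x ∈ X, (H.transition (a, x)).real X ≤ ρ := by
    intro a
    obtain ⟨B, hB⟩ := hX.isBounded.exists_norm_le
    let L := LinearMap.toContinuousLinearMap (Matrix.toEuclideanLin (H.F a))
    set S := H.G a * H.cov * (H.G a).transpose
    -- If `x` and `L x + y` both lie in `X`, of radius `B`, then `‖y‖ ≤ B + ‖L‖ * B`. One ball thus
    -- bounds the probability of staying, uniformly in `x`.
    let K := B + ‖L‖ * B
    refine ⟨(multivariateGaussian 0 S).real (Metric.closedBall 0 K), measureReal_nonneg, ?_, ?_⟩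
    · have h1 := probReal_add_probReal_compl (μ := multivariateGaussian 0 S)
        (Metric.isClosed_closedBall (x := 0) (ε := K)).measurableSet
      have h2 : 0 < (multivariateGaussian 0 S).real (Metric.closedBall 0 K)ᶜ :=
        ENNReal.toReal_pos (multivariateGaussian_compl_ne_zero (hH a) K) (measure_ne_top _ _)
      linarith
    · intro x hx
      rw [H.transition_apply, map_measureReal_apply (by fun_prop) hX.measurableSet]
      refine measureReal_mono fun y hy => ?_
      have h1 : ‖L x + y‖ ≤ B := hB _ hy
      have h2 : ‖L x‖ ≤ ‖L‖ * B :=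
        (L.le_opNorm x).trans (mul_le_mul_of_nonneg_left (hB x hx) (norm_nonneg _))
      rw [Metric.mem_closedBall, dist_zero_right]
      calc ‖y‖ = ‖(L x + y) - L x‖ := by rw [add_sub_cancel_left]
        _ ≤ ‖L x + y‖ + ‖L x‖ := norm_sub_le _ _
        _ ≤ K := add_le_add h1 h2
  choose ρ h0 h1 hρ using key
  cases isEmpty_or_nonempty A
  · exact ⟨0, le_rfl, one_pos, fun a => isEmptyElim a⟩
  · obtain ⟨a, ha⟩ := Finite.exists_max ρ
    exact ⟨ρ a, h0 a, h1 a, fun b x hx => (hρ b x hx).trans (ha b)⟩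

end SHS

/-! ### Value iteration for interval Markov decision processes -/

namespace IMDP

variable {Q A : Type*} [Fintype Q] (I : IMDP Q A)

theorem expectation_mem_Icc {γ v : Q → ℝ} (hγ : γ ∈ stdSimplex ℝ Q)
    (hv : ∀ q, v q ∈ Set.Icc (0 : ℝ) 1) : ∑ q, γ q * v q ∈ Set.Icc (0 : ℝ) 1 := by
  refine ⟨Finset.sum_nonneg fun q _ => mul_nonneg (hγ.1 q) (hv q).1, ?_⟩
  rw [← hγ.2]
  exact Finset.sum_le_sum fun q _ => mul_le_of_le_one_right (hγ.1 q) (hv q).2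

variable {I}

theorem minExp_le {v γ : Q → ℝ} {q : Q} {a : A} (hv : ∀ q, v q ∈ Set.Icc (0 : ℝ) 1)
    (hγ : γ ∈ I.feasible q a) : I.minExp v q a ≤ ∑ q', γ q' * v q' := by
  refine csInf_le ⟨0, ?_⟩ ⟨γ, hγ, rfl⟩
  rintro _ ⟨γ', hγ', rfl⟩
  exact (expectation_mem_Icc hγ'.1 hv).1

theorem le_maxExp {v γ : Q → ℝ} {q : Q} {a : A} (hv : ∀ q, v q ∈ Set.Icc (0 : ℝ) 1)
    (hγ : γ ∈ I.feasible q a) : ∑ q', γ q' * v q' ≤ I.maxExp v q a := by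
  refine le_csSup ⟨1, ?_⟩ ⟨γ, hγ, rfl⟩
  rintro _ ⟨γ', hγ', rfl⟩
  exact (expectation_mem_Icc hγ'.1 hv).2

theorem minExp_mem_Icc {v : Q → ℝ} (hv : ∀ q, v q ∈ Set.Icc (0 : ℝ) 1) (q : Q) (a : A) :
    I.minExp v q a ∈ Set.Icc (0 : ℝ) 1 := by
  refine ⟨Real.sInf_nonneg ?_, ?_⟩
  · rintro _ ⟨γ, hγ, rfl⟩
    exact (expectation_mem_Icc hγ.1 hv).1
  · rcases (I.feasible q a).eq_empty_or_nonempty with h | ⟨γ, hγ⟩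
    -- With no feasible distribution the infimum is `sInf ∅ = 0`.
    · simp [minExp, h]
    · exact (minExp_le hv hγ).trans (expectation_mem_Icc hγ.1 hv).2

theorem maxExp_mem_Icc {v : Q → ℝ} (hv : ∀ q, v q ∈ Set.Icc (0 : ℝ) 1) (q : Q) (a : A) :
    I.maxExp v q a ∈ Set.Icc (0 : ℝ) 1 := by
  refine ⟨Real.sSup_nonneg ?_, Real.sSup_le ?_ zero_le_one⟩
  · rintro _ ⟨γ, hγ, rfl⟩
    exact (expectation_mem_Icc hγ.1 hv).1
  · rintro _ ⟨γ, hγ, rfl⟩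
    exact (expectation_mem_Icc hγ.1 hv).2

theorem expectation_mono {γ v w : Q → ℝ} (hγ : γ ∈ stdSimplex ℝ Q) (hvw : ∀ q, v q ≤ w q) :
    ∑ q, γ q * v q ≤ ∑ q, γ q * w q :=
  Finset.sum_le_sum fun q _ => mul_le_mul_of_nonneg_left (hvw q) (hγ.1 q)

theorem minExp_mono {v w : Q → ℝ} {q : Q} {a : A} (hne : (I.feasible q a).Nonempty)
    (hv : ∀ q, v q ∈ Set.Icc (0 : ℝ) 1) (hvw : ∀ q, v q ≤ w q) :
    I.minExp v q a ≤ I.minExp w q a := by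
  refine le_csInf (hne.image _) ?_
  rintro _ ⟨γ, hγ, rfl⟩
  exact (minExp_le hv hγ).trans (expectation_mono hγ.1 hvw)

theorem maxExp_mono {v w : Q → ℝ} (hw : ∀ q, w q ∈ Set.Icc (0 : ℝ) 1)
    (hvw : ∀ q, v q ≤ w q) (q : Q) (a : A) : I.maxExp v q a ≤ I.maxExp w q a := by
  refine Real.sSup_le ?_ (maxExp_mem_Icc hw q a).1
  rintro _ ⟨γ, hγ, rfl⟩
  exact (expectation_mono hγ.1 hvw).trans (le_maxExp hw hγ)

variable (I) (T : Set Q) (σ : Q → A)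

theorem lowerIter_mem_Icc (n : ℕ) (q : Q) : I.lowerIter T n q ∈ Set.Icc (0 : ℝ) 1 := by
  induction n generalizing q with
  | zero => simp [lowerIter]
  | succ n ih =>
    rw [lowerIter]
    split_ifs
    · simp
    · exact ⟨Real.iSup_nonneg fun a => (minExp_mem_Icc ih q a).1,
        Real.iSup_le (fun a => (minExp_mem_Icc ih q a).2) zero_le_one⟩

theorem upperIter_mem_Icc (n : ℕ) (q : Q) : I.upperIter T σ n q ∈ Set.Icc (0 : ℝ) 1 := by
  induction n generalizing q with
  | zero => simp [upperIter]
  | succ n ih =>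
    rw [upperIter]
    split_ifs
    · simp
    · exact maxExp_mem_Icc ih q _

theorem bddAbove_range_lowerIter (q : Q) : BddAbove (Set.range fun n => I.lowerIter T n q) :=
  ⟨1, by rintro _ ⟨n, rfl⟩; exact (I.lowerIter_mem_Icc T n q).2⟩

theorem bddAbove_range_upperIter (q : Q) : BddAbove (Set.range fun n => I.upperIter T σ n q) :=
  ⟨1, by rintro _ ⟨n, rfl⟩; exact (I.upperIter_mem_Icc T σ n q).2⟩

theorem lowerValue_mem_Icc (q : Q) : I.lowerValue T q ∈ Set.Icc (0 : ℝ) 1 :=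
  ⟨Real.iSup_nonneg fun n => (I.lowerIter_mem_Icc T n q).1,
    Real.iSup_le (fun n => (I.lowerIter_mem_Icc T n q).2) zero_le_one⟩

theorem upperValue_mem_Icc (q : Q) : I.upperValue T σ q ∈ Set.Icc (0 : ℝ) 1 :=
  ⟨Real.iSup_nonneg fun n => (I.upperIter_mem_Icc T σ n q).1,
    Real.iSup_le (fun n => (I.upperIter_mem_Icc T σ n q).2) zero_le_one⟩

theorem upperIter_le_succ (n : ℕ) (q : Q) : I.upperIter T σ n q ≤ I.upperIter T σ (n + 1) q := by
  induction n generalizing q with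
  | zero => exact (I.upperIter_mem_Icc T σ 1 q).1
  | succ n ih =>
    rw [upperIter, upperIter]
    split_ifs
    · exact le_rfl
    · exact maxExp_mono (I.upperIter_mem_Icc T σ (n + 1)) ih q _

theorem tendsto_upperIter (q : Q) :
    Filter.Tendsto (fun n => I.upperIter T σ n q) Filter.atTop (nhds (I.upperValue T σ q)) :=
  tendsto_atTop_ciSup (monotone_nat_of_le_succ fun n => I.upperIter_le_succ T σ n q)
    (I.bddAbove_range_upperIter T σ q)

theorem one_le_upperValue {q : Q} (hq : q ∈ T) : 1 ≤ I.upperValue T σ q := by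
  have h : I.upperIter T σ 1 q = 1 := by simp [upperIter, hq]
  exact h.symm.le.trans (le_ciSup (I.bddAbove_range_upperIter T σ q) 1)

variable {I T σ}

/-- The upper bound is superharmonic. -/
theorem expectation_upperValue_le {q : Q} (hq : q ∉ T) {γ : Q → ℝ}
    (hγ : γ ∈ I.feasible q (σ q)) :
    ∑ q', γ q' * I.upperValue T σ q' ≤ I.upperValue T σ q := by
  have hlim : Filter.Tendsto (fun n => ∑ q', γ q' * I.upperIter T σ n q') Filter.atTop
      (nhds (∑ q', γ q' * I.upperValue T σ q')) :=
    tendsto_finsetSum _ fun q' _ => (I.tendsto_upperIter T σ q').const_mul _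
  -- The sum is finite, so the limit passes through it; each iterate satisfies `∑ γ v_n ≤ v_{n+1} ≤
  -- v`.
  refine le_of_tendsto' hlim fun n => ?_
  refine (le_maxExp (I.upperIter_mem_Icc T σ n) hγ).trans ?_
  have h : I.upperIter T σ (n + 1) q = I.maxExp (I.upperIter T σ n) q (σ q) := by
    rw [upperIter, if_neg hq]
  rw [← h]
  exact le_ciSup (I.bddAbove_range_upperIter T σ q) (n + 1)

/-- The lower bound is subharmonic under an optimal strategy. -/
theorem lowerValue_le_expectation (hσ : I.IsOptimal T σ) {q : Q} (hq : q ∉ T)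
    (hne : ∀ a, (I.feasible q a).Nonempty) {γ : Q → ℝ} (hγ : γ ∈ I.feasible q (σ q)) :
    I.lowerValue T q ≤ ∑ q', γ q' * I.lowerValue T q' := by
  refine le_trans ?_ (minExp_le (I.lowerValue_mem_Icc T) hγ)
  have h0 := (minExp_mem_Icc (I := I) (I.lowerValue_mem_Icc T) q (σ q)).1
  refine Real.iSup_le (fun n => ?_) h0
  cases n with
  | zero => exact h0
  | succ n =>
    rw [lowerIter, if_neg hq]
    -- Only the inequality is needed: each iterate is below the limit, so monotonicity and
    -- optimality of `σ` suffice, with no exchange of limit and minimum.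
    refine Real.iSup_le (fun a => (minExp_mono (hne a) (I.lowerIter_mem_Icc T n) fun q' => ?_).trans
      (hσ q hq a)) h0
    exact le_ciSup (I.bddAbove_range_lowerIter T q') n

/-- The lower bound vanishes on a set which avoids the target and cannot be left. -/
theorem lowerValue_eq_zero {S : Set Q} (hST : ∀ q ∈ S, q ∉ T)
    (hS : ∀ q ∈ S, ∀ a, ∀ q' ∉ S, I.upper q a q' ≤ 0) {q : Q} (hq : q ∈ S) :
    I.lowerValue T q = 0 := by
  have key : ∀ n, ∀ q ∈ S, I.lowerIter T n q = 0 := by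
    intro n
    induction n with
    | zero => exact fun q _ => rfl
    | succ n ih =>
      intro q hq
      -- A feasible `γ` has no mass outside `S`, and the previous iterate vanishes on `S`.
      have hsum : ∀ a, ∀ γ ∈ I.feasible q a, ∑ q', γ q' * I.lowerIter T n q' = 0 := by
        intro a γ hγ
        refine Finset.sum_eq_zero fun q' _ => ?_
        by_cases h : q' ∈ S
        · rw [ih q' h, mul_zero]
        · rw [le_antisymm ((hγ.2 q').2.trans (hS q hq a q' h)) (hγ.1.1 q'), zero_mul]
      have hmin : ∀ a, I.minExp (I.lowerIter T n) q a = 0 := by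
        intro a
        rcases (I.feasible q a).eq_empty_or_nonempty with h | ⟨γ, hγ⟩
        · simp [minExp, h]
        · exact le_antisymm ((minExp_le (I.lowerIter_mem_Icc T n) hγ).trans (hsum a γ hγ).le)
            (minExp_mem_Icc (I.lowerIter_mem_Icc T n) q a).1
      rw [lowerIter, if_neg (hST q hq)]
      simp [hmin]
  simp [lowerValue, key _ q hq]

end IMDP

/-! ### Cells and quantizers -/

namespace IsPolytope

variable {m : ℕ} {P : Set (EuclideanSpace ℝ (Fin m))}

theorem isCompact (hP : IsPolytope P) : IsCompact P := by
  obtain ⟨V, -, rfl⟩ := hP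
  exact V.finite_toSet.isCompact_convexHull ℝ

theorem convex (hP : IsPolytope P) : Convex ℝ P := by
  obtain ⟨V, -, rfl⟩ := hP
  exact convex_convexHull ℝ _

theorem interior_nonempty (hP : IsPolytope P) : (interior P).Nonempty := by
  obtain ⟨V, hV, rfl⟩ := hP
  exact interior_convexHull_nonempty_iff_affineSpan_eq_top.2 hV

end IsPolytope

namespace Discretization

variable {A Υ Z : Type*} {m r : ℕ} {X : Set (EuclideanSpace ℝ (Fin m))}

theorem cell_subset (D : Discretization A X) (a : A) (i : Fin (D.num a)) : D.cell a i ⊆ X :=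
  (Set.subset_iUnion (D.cell a) i).trans (D.iUnion_cell a).le

/-- The points that lie in more than one cell of mode `a`. -/
def overlap (D : Discretization A X) (a : A) : Set (EuclideanSpace ℝ (Fin m)) :=
  {x | ∃ i j, i ≠ j ∧ x ∈ D.cell a i ∩ D.cell a j}

theorem volume_overlap (D : Discretization A X) (a : A) : volume (D.overlap a) = 0 := by
  have h : D.overlap a = ⋃ i, ⋃ j, ⋃ _ : i ≠ j, D.cell a i ∩ D.cell a j := by
    ext x; simp only [overlap, Set.mem_iUnion, exists_prop, Set.mem_ofPred_eq]
  rw [h]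
  simp only [measure_iUnion_null_iff]
  exact fun i j hij => D.null_inter a i j hij

/-- An interior point of a cell lies in no other cell. -/
theorem eq_of_mem_interior (D : Discretization A X) {a : A} {i : Fin (D.num a)}
    {x : EuclideanSpace ℝ (Fin m)} (hx : x ∈ interior (D.cell a i)) {j : Fin (D.num a)}
    (hj : x ∈ D.cell a j) : j = i := by
  by_contra hne
  -- A full-dimensional convex set lies in the closure of its interior, so the two interiors would
  -- meet in a nonempty open set, of positive volume.
  have hcl : x ∈ closure (interior (D.cell a j)) := by
    rw [(D.isPolytope a j).convex.closure_interior_eq_closure_of_nonempty_interior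
      (D.isPolytope a j).interior_nonempty]
    exact subset_closure hj
  obtain ⟨y, hyi, hyj⟩ := mem_closure_iff.1 hcl _ isOpen_interior hx
  have hpos := (isOpen_interior.inter isOpen_interior).measure_pos volume ⟨y, hyi, hyj⟩
  refine hpos.ne' (measure_mono_null ?_ (D.null_inter a i j (Ne.symm hne)))
  exact Set.inter_subset_inter interior_subset interior_subset

namespace Quantizer

variable [MeasurableSpace A] {D : Discretization A X} (J : D.Quantizer)

theorem eq_none_iff (s : A × EuclideanSpace ℝ (Fin m)) : J.toFun s = none ↔ s.2 ∉ X := by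
  obtain ⟨a, x⟩ := s
  refine ⟨fun h hx => ?_, J.eq_none a x⟩
  obtain ⟨i, hi, -⟩ := J.mem_cell a x hx
  simp [hi] at h

theorem mem_of_eq_some {a b : A} {x : EuclideanSpace ℝ (Fin m)} {i : Fin (D.num b)}
    (h : J.toFun (a, x) = some ⟨b, i⟩) : b = a ∧ x ∈ D.cell b i := by
  have hx : x ∈ X := by
    by_contra hx
    simp [J.eq_none a x hx] at h
  obtain ⟨j, hj, hxj⟩ := J.mem_cell a x hx
  rw [hj, Option.some.injEq, Sigma.mk.injEq] at h
  obtain ⟨rfl, h⟩ := h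
  rw [← eq_of_heq h]
  exact ⟨rfl, hxj⟩

theorem measurable_toFun [Finite A] : Measurable[_, ⊤] J.toFun := by
  let _ : MeasurableSpace D.State := ⊤
  exact measurable_to_countable' J.measurableSet_fiber

/-- Off the overlaps of the cells, the labels of a hybrid state and of its cell agree. -/
theorem label_eq {H : SHS A Υ m r} {R : Υ → Set (EuclideanSpace ℝ (Fin m))}
    (hRX : ∀ p, R p ⊆ X) (hL : ∀ p a x, p ∈ H.label (a, x) ↔ x ∈ R p) (hD : D.Respects R)
    {s : A × EuclideanSpace ℝ (Fin m)} (hs : s.2 ∉ D.overlap s.1) :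
    H.label s = D.label R (J.toFun s) := by
  obtain ⟨a, x⟩ := s
  ext p
  rw [hL]
  by_cases hx : x ∈ X
  · obtain ⟨i, hi, hxi⟩ := J.mem_cell a x hx
    rw [hi]
    refine ⟨fun hp => ?_, fun hp => hp hxi⟩
    obtain ⟨C, hC⟩ := hD p a
    rw [← hC] at hp
    simp only [Set.mem_iUnion] at hp
    obtain ⟨j, hjC, hxj⟩ := hp
    -- Off the overlaps, the cell chosen by `J` is the one that witnesses `x ∈ R p`, so that whole
    -- cell lies in `R p`.
    have hij : i = j := by
      by_contra hij
      exact hs ⟨i, j, hij, hxi, hxj⟩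
    subst hij
    change D.cell a i ⊆ R p
    rw [← hC]
    exact Set.subset_biUnion_of_mem (u := fun i => D.cell a i) hjC
  · rw [J.eq_none a x hx]
    exact ⟨fun hp => absurd (hRX p hp) hx, fun hp => hp.elim⟩

/-- A fiber and its cell differ only inside the overlaps, which are null. -/
theorem measure_fiber {μ : Measure (EuclideanSpace ℝ (Fin m))} (hμ : μ ≪ volume) (a : A)
    (i : Fin (D.num a)) :
    μ {x | J.toFun (a, x) = some ⟨a, i⟩} = μ (D.cell a i) := by
  refine measure_congr ?_
  have h0 : ∀ᵐ x ∂μ, x ∉ D.overlap a := measure_eq_zero_iff_ae_notMem.1 (hμ (D.volume_overlap a))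
  filter_upwards [h0] with x hx
  refine propext ⟨fun h => (J.mem_of_eq_some h).2, fun h => ?_⟩
  obtain ⟨j, hj, hxj⟩ := J.mem_cell a x (D.cell_subset a i h)
  have : j = i := by
    by_contra hne
    exact hx ⟨j, i, hne, hxj, h⟩
  subst this
  exact hj

/-- The product state that follows the DFA state `z` when the hybrid process moves to `s`. -/
def productState (R : Υ → Set (EuclideanSpace ℝ (Fin m))) (M : DFA (Set Υ) Z) (z : Z)
    (s : A × EuclideanSpace ℝ (Fin m)) : D.State × Z :=
  (J.toFun s, M.step z (D.label R (J.toFun s)))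

theorem measurable_productState [Finite A] (R : Υ → Set (EuclideanSpace ℝ (Fin m)))
    (M : DFA (Set Υ) Z) (z : Z) : Measurable[_, ⊤] (J.productState R M z) := by
  let _ : MeasurableSpace D.State := ⊤
  let _ : MeasurableSpace (D.State × Z) := ⊤
  exact (Measurable.of_discrete (f := fun q : D.State => (q, M.step z (D.label R q)))).comp
    J.measurable_toFun

variable [DiscreteMeasurableSpace A]

/-- The distribution of the next product state. -/
noncomputable def successorDist [Countable A] (H : SHS A Υ m r)
    (R : Υ → Set (EuclideanSpace ℝ (Fin m))) (M : DFA (Set Υ) Z) (z : Z) (b : A)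
    (x : EuclideanSpace ℝ (Fin m)) (p : D.State × Z) : ℝ :=
  (H.transition (b, x)).real {y | J.productState R M z (b, y) = p}

variable [Fintype A] [Fintype Z]

theorem integral_productState (H : SHS A Υ m r) (R : Υ → Set (EuclideanSpace ℝ (Fin m)))
    (M : DFA (Set Υ) Z) (z : Z) (b : A) (x : EuclideanSpace ℝ (Fin m)) (v : D.State × Z → ℝ) :
    ∫ y, v (J.productState R M z (b, y)) ∂H.transition (b, x) =
      ∑ p, J.successorDist H R M z b x p * v p := by
  let _ : MeasurableSpace (D.State × Z) := ⊤
  have hΦ : Measurable fun y => J.productState R M z (b, y) :=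
    (J.measurable_productState R M z).comp measurable_prodMk_left
  have : IsProbabilityMeasure ((H.transition (b, x)).map fun y => J.productState R M z (b, y)) :=
    Measure.isProbabilityMeasure_map hΦ.aemeasurable
  rw [← integral_map (f := v) hΦ.aemeasurable Measurable.of_discrete.aestronglyMeasurable,
    integral_fintype Integrable.of_finite]
  refine Finset.sum_congr rfl fun p _ => ?_
  rw [map_measureReal_apply hΦ (MeasurableSet.singleton p)]
  rfl

/-- This is the soundness of the abstraction. The mass of a fiber is `T(q' ∣ x, b)`, which lies
between its extrema over the cell containing `x`; product states with the wrong mode or automaton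
state have empty fiber. -/
theorem successorDist_mem_feasible (H : SHS A Υ m r)
    (hH : ∀ a, (H.G a * H.cov * (H.G a).transpose).PosDef) (hX : MeasurableSet X)
    (R : Υ → Set (EuclideanSpace ℝ (Fin m))) (M : DFA (Set Υ) Z)
    (c : Σ a : A, Fin (D.num a)) (z : Z) (b : A) {x : EuclideanSpace ℝ (Fin m)}
    (hx : x ∈ D.cell c.1 c.2) :
    J.successorDist H R M z b x ∈ ((D.abstraction H).prod (D.label R) M).feasible (some c, z) b := by
  have hle : ∀ S : Set (EuclideanSpace ℝ (Fin m)),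
      BddAbove (Set.range fun x : D.cell c.1 c.2 => (H.transition (b, x)).real S) :=
    fun S => ⟨1, by rintro _ ⟨y, rfl⟩; exact measureReal_le_one⟩
  have hge : ∀ S : Set (EuclideanSpace ℝ (Fin m)),
      BddBelow (Set.range fun x : D.cell c.1 c.2 => (H.transition (b, x)).real S) :=
    fun S => ⟨0, by rintro _ ⟨y, rfl⟩; exact measureReal_nonneg⟩
  have hsup : ∀ S : Set (EuclideanSpace ℝ (Fin m)), (H.transition (b, x)).real S ≤
      ⨆ x : D.cell c.1 c.2, (H.transition (b, x)).real S := fun S => le_ciSup (hle S) ⟨x, hx⟩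
  have hinf : ∀ S : Set (EuclideanSpace ℝ (Fin m)),
      ⨅ x : D.cell c.1 c.2, (H.transition (b, x)).real S ≤ (H.transition (b, x)).real S :=
    fun S => ciInf_le (hge S) ⟨x, hx⟩
  refine ⟨⟨fun p => measureReal_nonneg, ?_⟩, ?_⟩
  · have := J.integral_productState H R M z b x fun _ => 1
    simpa using this.symm
  · rintro ⟨q, z'⟩
    by_cases hz : z' = M.step z (D.label R q)
    · subst hz
      have hset : {y | J.productState R M z (b, y) = (q, M.step z (D.label R q))} =
          {y | J.toFun (b, y) = q} := by
        ext y
        simp only [productState, Prod.mk.injEq, Set.mem_ofPred_eq]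
        exact ⟨fun h => h.1, fun h => ⟨h, by rw [h]⟩⟩
      simp only [IMDP.prod, if_true, successorDist, hset]
      rcases q with _ | ⟨d, j⟩
      · have hc : {y | J.toFun (b, y) = none} = Xᶜ := by
          ext y; exact J.eq_none_iff (b, y)
        rw [hc, probReal_compl_eq_one_sub hX]
        exact ⟨sub_le_sub_left (hsup X) 1, sub_le_sub_left (hinf X) 1⟩
      · by_cases hd : d = b
        · subst hd
          have hm : (H.transition (d, x)).real {y | J.toFun (d, y) = some ⟨d, j⟩} =
              (H.transition (d, x)).real (D.cell d j) :=
            congrArg ENNReal.toReal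
              (J.measure_fiber (H.transition_absolutelyContinuous (hH d) x) d j)
          simp only [abstraction, if_true, hm]
          exact ⟨hinf _, hsup _⟩
        · have hm : {y | J.toFun (b, y) = some ⟨d, j⟩} = ∅ :=
            Set.eq_empty_of_forall_notMem fun y hy => hd (J.mem_of_eq_some hy).1
          simp [abstraction, hd, hm]
    · have hset : {y | J.productState R M z (b, y) = (q, z')} = ∅ := by
        refine Set.eq_empty_of_forall_notMem fun y hy => hz ?_
        simp only [productState, Prod.mk.injEq, Set.mem_ofPred_eq] at hy
        rw [← hy.2, hy.1]
      simp [IMDP.prod, if_neg hz, successorDist, hset]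

end Quantizer

end Discretization

/-! ### The controlled process -/

namespace SHS

variable {A Υ : Type*} {m r : ℕ} [MeasurableSpace A] [DiscreteMeasurableSpace A] [Countable A]
  (H : SHS A Υ m r) (σ : SwitchingStrategy A m) (s₀ : A × EuclideanSpace ℝ (Fin m))

instance : IsProbabilityMeasure (H.pathLaw σ s₀) := by
  unfold pathLaw; infer_instance

theorem ae_pathLaw_zero : ∀ᵐ ω ∂H.pathLaw σ s₀, ω 0 = s₀ := by
  have h := Kernel.traj_map_frestrictLe_apply (X := fun _ => A × EuclideanSpace ℝ (Fin m))
    (κ := H.controlled σ) 0 0 (fun _ => s₀)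
  rw [Kernel.partialTraj_self, Kernel.id_apply] at h
  have h2 : ∀ᵐ f ∂(Measure.map (Preorder.frestrictLe 0) (H.pathLaw σ s₀)),
      f ⟨0, Finset.mem_Iic.2 le_rfl⟩ = s₀ := by
    unfold pathLaw
    rw [h, ae_dirac_iff]
    exact measurableSet_eq_fun (measurable_pi_apply _) measurable_const
  exact ae_of_ae_map (by fun_prop) h2

theorem map_pathLaw_succ (k : ℕ) :
    (H.pathLaw σ s₀).map (fun ω => (Preorder.frestrictLe k ω, ω (k + 1))) =
      (H.pathLaw σ s₀).map (Preorder.frestrictLe k) ⊗ₘ H.controlled σ k := by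
  unfold pathLaw
  rw [Kernel.traj_map_frestrictLe_apply, ← Kernel.partialTraj_compProd_eq_map_traj (zero_le)]

theorem controlled_apply (k : ℕ) (h : Finset.Iic k → A × EuclideanSpace ℝ (Fin m)) :
    H.controlled σ k h = (H.transition (σ.mode k h, (h ⟨k, by simp⟩).2)).map
      (Prod.mk (σ.mode k h)) := by
  rw [controlled, Kernel.comap_apply, move, Kernel.prod_apply, Kernel.deterministic_apply,
    Kernel.comap_apply, Measure.dirac_prod]

/-- Given the past, the next position has an absolutely continuous law. Time 0 is not covered, hence
the separate label condition on the initial state. -/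
theorem ae_pathLaw_succ (hH : ∀ a, (H.G a * H.cov * (H.G a).transpose).PosDef)
    {N : A → Set (EuclideanSpace ℝ (Fin m))} (hN : ∀ a, volume (N a) = 0) (k : ℕ) :
    ∀ᵐ ω ∂H.pathLaw σ s₀, (ω (k + 1)).2 ∉ N (ω (k + 1)).1 := by
  -- The sets `N a` need not be measurable; measurable hulls have the same volume.
  let B : Set (A × EuclideanSpace ℝ (Fin m)) :=
    {s | s.2 ∈ toMeasurable volume (N s.1)}
  have hB : MeasurableSet B := by
    have h : B = ⋃ a, {a} ×ˢ toMeasurable volume (N a) := by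
      ext ⟨a, x⟩; simp [B]
    rw [h]
    exact MeasurableSet.iUnion fun a =>
      (MeasurableSet.singleton a).prod (measurableSet_toMeasurable _ _)
  have hctrl : ∀ h, H.controlled σ k h B = 0 := by
    intro h
    rw [controlled_apply, Measure.map_apply measurable_prodMk_left hB]
    refine H.transition_absolutelyContinuous (hH _) _ ?_
    change volume (toMeasurable volume (N _)) = 0
    rw [measure_toMeasurable, hN]
  have h0 : ((H.pathLaw σ s₀).map fun ω => (Preorder.frestrictLe k ω, ω (k + 1)))
      (Set.univ ×ˢ B) = 0 := by
    rw [map_pathLaw_succ, Measure.compProd_apply_prod MeasurableSet.univ hB]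
    simp [hctrl]
  rw [Measure.map_apply (by fun_prop) (MeasurableSet.univ.prod hB)] at h0
  filter_upwards [measure_eq_zero_iff_ae_notMem.1 h0] with ω hω hmem
  exact hω ⟨trivial, subset_toMeasurable _ _ hmem⟩

/-- One-step disintegration of the path law. -/
theorem integral_pathLaw_succ {β : Type*} [MeasurableSpace β] (k : ℕ)
    {Y : (Finset.Iic k → A × EuclideanSpace ℝ (Fin m)) → β} (hY : Measurable Y)
    {f : β × (A × EuclideanSpace ℝ (Fin m)) → ℝ} (hf : Measurable f) {C : ℝ}
    (hC : ∀ p, ‖f p‖ ≤ C) :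
    Integrable (fun ω : ℕ → A × EuclideanSpace ℝ (Fin m) =>
      ∫ y, f (Y (Preorder.frestrictLe k ω), (σ.mode k (Preorder.frestrictLe k ω), y))
        ∂H.transition (σ.mode k (Preorder.frestrictLe k ω), (ω k).2)) (H.pathLaw σ s₀) ∧
    ∫ ω, f (Y (Preorder.frestrictLe k ω), ω (k + 1)) ∂H.pathLaw σ s₀ =
      ∫ ω, ∫ y, f (Y (Preorder.frestrictLe k ω), (σ.mode k (Preorder.frestrictLe k ω), y))
        ∂H.transition (σ.mode k (Preorder.frestrictLe k ω), (ω k).2) ∂H.pathLaw σ s₀ := by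
  have hg : Measurable fun p : (Finset.Iic k → A × EuclideanSpace ℝ (Fin m)) ×
      (A × EuclideanSpace ℝ (Fin m)) => f (Y p.1, p.2) := by fun_prop
  have hμ : IsProbabilityMeasure ((H.pathLaw σ s₀).map (Preorder.frestrictLe k)) :=
    Measure.isProbabilityMeasure_map (by fun_prop)
  have hint : Integrable (fun p : (Finset.Iic k → A × EuclideanSpace ℝ (Fin m)) ×
      (A × EuclideanSpace ℝ (Fin m)) => f (Y p.1, p.2))
      ((H.pathLaw σ s₀).map (Preorder.frestrictLe k) ⊗ₘ H.controlled σ k) :=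
    Integrable.of_bound hg.aestronglyMeasurable C (Filter.Eventually.of_forall fun p => hC _)
  have hinner : ∀ h : Finset.Iic k → A × EuclideanSpace ℝ (Fin m),
      ∫ s, f (Y h, s) ∂H.controlled σ k h =
        ∫ y, f (Y h, (σ.mode k h, y)) ∂H.transition (σ.mode k h, (h ⟨k, by simp⟩).2) := by
    intro h
    have hfY : Measurable fun s => f (Y h, s) := hf.comp measurable_prodMk_left
    rw [controlled_apply, integral_map measurable_prodMk_left.aemeasurable
      hfY.aestronglyMeasurable]
  have h1 : Integrable (fun h => ∫ s, f (Y h, s) ∂H.controlled σ k h)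
      ((H.pathLaw σ s₀).map (Preorder.frestrictLe k)) :=
    Integrable.integral_compProd (κ := Kernel.const Unit _)
      (η := Kernel.prodMkLeft Unit (H.controlled σ k)) (a := ()) hint
  have h2 := Measure.integral_compProd hint
  simp only [hinner] at h1 h2
  constructor
  · exact h1.comp_measurable (Preorder.measurable_frestrictLe k)
  · rw [← map_pathLaw_succ, integral_map (by fun_prop) hg.aestronglyMeasurable,
      integral_map (by fun_prop) h1.aestronglyMeasurable] at h2
    exact h2

end SHS

/-! ### The stopped product process -/

namespace Discretization.Quantizer

variable {A Υ Z : Type*} {m r : ℕ} {X : Set (EuclideanSpace ℝ (Fin m))} [MeasurableSpace A]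
  {D : Discretization A X} (J : D.Quantizer) (R : Υ → Set (EuclideanSpace ℝ (Fin m)))
  (M : DFA (Set Υ) Z)

/-- The states of the product at which the process is stopped. -/
def stopped (D : Discretization A X) (M : DFA (Set Υ) Z) : Set (D.State × Z) :=
  {p | p.1 = none ∨ p ∈ D.accepting M}

/-- The state of the DFA after reading the abstract labels of `ω 0, …, ω k`. -/
def dfaState (ω : ℕ → A × EuclideanSpace ℝ (Fin m)) (k : ℕ) : Z :=
  M.eval (List.ofFn fun i : Fin (k + 1) => D.label R (J.toFun (ω i)))

open Classical in
/-- The path of the product, stopped when it leaves `X` or accepts. -/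
noncomputable def stoppedPath (ω : ℕ → A × EuclideanSpace ℝ (Fin m)) : ℕ → D.State × Z
  | 0 => J.productState R M M.start (ω 0)
  | k + 1 => if stoppedPath ω k ∈ stopped D M then stoppedPath ω k
      else J.productState R M (stoppedPath ω k).2 (ω (k + 1))

theorem dfaState_zero (ω : ℕ → A × EuclideanSpace ℝ (Fin m)) :
    J.dfaState R M ω 0 = (J.productState R M M.start (ω 0)).2 := by
  simp [dfaState, productState, DFA.eval, DFA.evalFrom]

theorem dfaState_succ (ω : ℕ → A × EuclideanSpace ℝ (Fin m)) (k : ℕ) :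
    J.dfaState R M ω (k + 1) =
      (J.productState R M (J.dfaState R M ω k) (ω (k + 1))).2 := by
  rw [dfaState, List.ofFn_succ', List.concat_eq_append, DFA.eval_append_singleton]
  rfl

/-- Some initial segment of `ω 0, …, ω k` remains in `X` and is accepted by the DFA. -/
def AcceptedBy (ω : ℕ → A × EuclideanSpace ℝ (Fin m)) (k : ℕ) : Prop :=
  ∃ j ≤ k, (∀ i ≤ j, (ω i).2 ∈ X) ∧ J.dfaState R M ω j ∈ M.accept

theorem acceptedBy_succ (ω : ℕ → A × EuclideanSpace ℝ (Fin m)) (k : ℕ) :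
    J.AcceptedBy R M ω (k + 1) ↔ J.AcceptedBy R M ω k ∨
      ((∀ i ≤ k + 1, (ω i).2 ∈ X) ∧ J.dfaState R M ω (k + 1) ∈ M.accept) := by
  constructor
  · rintro ⟨j, hj, h⟩
    rcases Nat.lt_or_eq_of_le hj with hj | rfl
    · exact Or.inl ⟨j, Nat.lt_succ_iff.1 hj, h⟩
    · exact Or.inr h
  · rintro (⟨j, hj, h⟩ | h)
    · exact ⟨j, hj.trans k.le_succ, h⟩
    · exact ⟨k + 1, le_rfl, h⟩

/-- The stopped path has accepted, or has left `X`, or is the current state of the product. -/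
theorem stoppedPath_cases (ω : ℕ → A × EuclideanSpace ℝ (Fin m)) (k : ℕ) :
    (J.stoppedPath R M ω k ∈ D.accepting M ∧ J.AcceptedBy R M ω k) ∨
    ((J.stoppedPath R M ω k).1 = none ∧ ¬ J.AcceptedBy R M ω k ∧ ¬ ∀ i ≤ k, (ω i).2 ∈ X) ∨
    (J.stoppedPath R M ω k ∉ stopped D M ∧ ¬ J.AcceptedBy R M ω k ∧ (∀ i ≤ k, (ω i).2 ∈ X) ∧
      J.stoppedPath R M ω k = (J.toFun (ω k), J.dfaState R M ω k)) := by
  induction k with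
  | zero =>
    have h0 : J.stoppedPath R M ω 0 = (J.toFun (ω 0), J.dfaState R M ω 0) := by
      rw [dfaState_zero]; rfl
    have hacc : J.AcceptedBy R M ω 0 ↔ (ω 0).2 ∈ X ∧ J.dfaState R M ω 0 ∈ M.accept := by
      simp [AcceptedBy]
    rw [hacc, h0]
    by_cases hX : (ω 0).2 ∈ X
    · have hn : J.toFun (ω 0) ≠ none := fun h => (J.eq_none_iff _).1 h hX
      by_cases hM : J.dfaState R M ω 0 ∈ M.accept
      · exact Or.inl ⟨⟨hn, hM⟩, hX, hM⟩
      · exact Or.inr (Or.inr ⟨fun h => h.elim hn fun h => hM h.2, fun h => hM h.2,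
          by simpa using hX, rfl⟩)
    · exact Or.inr (Or.inl ⟨(J.eq_none_iff _).2 hX, fun h => hX h.1, fun h => hX (h 0 le_rfl)⟩)
  | succ k ih =>
    rw [acceptedBy_succ]
    rcases ih with ⟨hT, hA⟩ | ⟨hn, hA, hX⟩ | ⟨hs, hA, hX, heq⟩
    · have h1 : J.stoppedPath R M ω (k + 1) = J.stoppedPath R M ω k := by
        rw [stoppedPath, if_pos (show _ ∈ stopped D M from Or.inr hT)]
      exact Or.inl ⟨h1 ▸ hT, Or.inl hA⟩
    · have h1 : J.stoppedPath R M ω (k + 1) = J.stoppedPath R M ω k := by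
        rw [stoppedPath, if_pos (show _ ∈ stopped D M from Or.inl hn)]
      have hX' : ¬ ∀ i ≤ k + 1, (ω i).2 ∈ X := fun h => hX fun i hi => h i (hi.trans k.le_succ)
      exact Or.inr (Or.inl ⟨h1 ▸ hn, not_or.2 ⟨hA, fun h => hX' h.1⟩, hX'⟩)
    · have h1 : J.stoppedPath R M ω (k + 1) = (J.toFun (ω (k + 1)), J.dfaState R M ω (k + 1)) := by
        rw [stoppedPath, if_neg hs, heq, dfaState_succ]; rfl
      rw [h1]
      have halive : (∀ i ≤ k + 1, (ω i).2 ∈ X) ↔ (ω (k + 1)).2 ∈ X := by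
        refine ⟨fun h => h _ le_rfl, fun h i hi => ?_⟩
        rcases Nat.lt_or_eq_of_le hi with hi | rfl
        · exact hX i (Nat.lt_succ_iff.1 hi)
        · exact h
      rw [halive]
      by_cases hX1 : (ω (k + 1)).2 ∈ X
      · have hn : J.toFun (ω (k + 1)) ≠ none := fun h => (J.eq_none_iff _).1 h hX1
        by_cases hM : J.dfaState R M ω (k + 1) ∈ M.accept
        · exact Or.inl ⟨⟨hn, hM⟩, Or.inr ⟨hX1, hM⟩⟩
        · exact Or.inr (Or.inr ⟨fun h => h.elim hn fun h => hM h.2,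
            not_or.2 ⟨hA, fun h => hM h.2⟩, hX1, rfl⟩)
      · exact Or.inr (Or.inl ⟨(J.eq_none_iff _).2 hX1, not_or.2 ⟨hA, fun h => hX1 h.1⟩, hX1⟩)

theorem stoppedPath_mem_accepting_iff (ω : ℕ → A × EuclideanSpace ℝ (Fin m)) (k : ℕ) :
    J.stoppedPath R M ω k ∈ D.accepting M ↔ J.AcceptedBy R M ω k := by
  rcases J.stoppedPath_cases R M ω k with ⟨h, hA⟩ | ⟨h, hA, -⟩ | ⟨h, hA, -⟩
  · exact iff_of_true h hA
  · exact iff_of_false (fun h' => h'.1 h) hA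
  · exact iff_of_false (fun h' => h (Or.inr h')) hA

/-- Adaptedness: this is the form in which the one-step disintegration can be applied. -/
theorem exists_stoppedPath_eq [Finite A] [Finite Z] (k : ℕ) :
    ∃ Y : (Finset.Iic k → A × EuclideanSpace ℝ (Fin m)) → D.State × Z, Measurable[_, ⊤] Y ∧
      ∀ ω, J.stoppedPath R M ω k = Y (Preorder.frestrictLe k ω) := by
  classical
  let _ : MeasurableSpace (D.State × Z) := ⊤
  induction k with
  | zero =>
    exact ⟨fun h => J.productState R M M.start (h ⟨0, by simp⟩),
      (J.measurable_productState R M _).comp (measurable_pi_apply _), fun ω => rfl⟩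
  | succ k ih =>
    obtain ⟨Y, hY, h⟩ := ih
    have hstep : Measurable fun p : (D.State × Z) × (A × EuclideanSpace ℝ (Fin m)) =>
        if p.1 ∈ stopped D M then p.1 else J.productState R M p.1.2 p.2 := by
      refine measurable_from_prod_countable_right fun p => ?_
      by_cases hp : p ∈ stopped D M
      · simp [hp]
      · simpa [hp] using J.measurable_productState R M p.2
    let res : (Finset.Iic (k + 1) → A × EuclideanSpace ℝ (Fin m)) →
        Finset.Iic k → A × EuclideanSpace ℝ (Fin m) :=
      Preorder.frestrictLe₂ (π := fun _ => A × EuclideanSpace ℝ (Fin m)) k.le_succ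
    have hres : Measurable res := Preorder.measurable_frestrictLe₂ _
    have hlast : Measurable fun h : Finset.Iic (k + 1) → A × EuclideanSpace ℝ (Fin m) =>
        h ⟨k + 1, by simp⟩ := measurable_pi_apply _
    refine ⟨_, hstep.comp ((hY.comp hres).prodMk hlast), fun ω => ?_⟩
    rw [stoppedPath, h ω]
    rfl

theorem measurable_stoppedPath [Finite A] [Finite Z] (k : ℕ) :
    Measurable[_, ⊤] fun ω : ℕ → A × EuclideanSpace ℝ (Fin m) => J.stoppedPath R M ω k := by
  obtain ⟨Y, hY, h⟩ := J.exists_stoppedPath_eq R M k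
  simp only [h]
  exact hY.comp (Preorder.measurable_frestrictLe k)

variable {R M} in
theorem monotone_accepting :
    Monotone fun k => {ω | J.stoppedPath R M ω k ∈ D.accepting M} := by
  intro k l hkl ω hω
  simp only [Set.mem_ofPred_eq, stoppedPath_mem_accepting_iff] at hω ⊢
  obtain ⟨j, hj, h⟩ := hω
  exact ⟨j, hj.trans hkl, h⟩

variable {R M} in
theorem measurableSet_stoppedPath_mem [Finite A] [Finite Z] (S : Set (D.State × Z)) (k : ℕ) :
    MeasurableSet {ω | J.stoppedPath R M ω k ∈ S} :=
  J.measurable_stoppedPath R M k MeasurableSpace.measurableSet_top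

variable {R M} in
theorem exists_cell_of_notMem_stopped {ω : ℕ → A × EuclideanSpace ℝ (Fin m)} {k : ℕ}
    (hs : J.stoppedPath R M ω k ∉ stopped D M) :
    ∃ c : Σ a : A, Fin (D.num a), (ω k).2 ∈ D.cell c.1 c.2 ∧
      J.stoppedPath R M ω k = (some c, (J.stoppedPath R M ω k).2) := by
  rcases J.stoppedPath_cases R M ω k with ⟨h, -⟩ | ⟨h, -⟩ | ⟨-, -, hX, h⟩
  · exact absurd (Or.inr h) hs
  · exact absurd (Or.inl h) hs
  · obtain ⟨i, hi, hx⟩ := J.mem_cell (ω k).1 (ω k).2 (hX k le_rfl)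
    exact ⟨⟨_, i⟩, hx, by rw [h, ← hi]⟩

theorem mode_refine [Finite A] (σ : D.State × Z → A) (ω : ℕ → A × EuclideanSpace ℝ (Fin m))
    (k : ℕ) : (Discretization.refine J R M σ).mode k (Preorder.frestrictLe k ω) =
      σ (J.toFun (ω k), J.dfaState R M ω k) :=
  rfl

variable [DiscreteMeasurableSpace A] [Fintype A] (H : SHS A Υ m r)
  (σ : D.State × Z → A) (s₀ : A × EuclideanSpace ℝ (Fin m))

theorem integral_stoppedPath_zero (v : D.State × Z → ℝ) :
    ∫ ω, v (J.stoppedPath R M ω 0) ∂H.pathLaw (Discretization.refine J R M σ) s₀ =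
      v (J.productState R M M.start s₀) := by
  have h : (fun ω => v (J.stoppedPath R M ω 0))
      =ᵐ[H.pathLaw (Discretization.refine J R M σ) s₀]
        fun _ => v (J.productState R M M.start s₀) := by
    filter_upwards [H.ae_pathLaw_zero (Discretization.refine J R M σ) s₀] with ω hω
    rw [stoppedPath, hω]
  rw [integral_congr_ae h]
  simp

variable [Fintype Z]

theorem integrable_stoppedPath (v : D.State × Z → ℝ) (k : ℕ) :
    Integrable (fun ω => v (J.stoppedPath R M ω k))
      (H.pathLaw (Discretization.refine J R M σ) s₀) := by
  let _ : MeasurableSpace (D.State × Z) := ⊤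
  obtain ⟨C, hC⟩ := (Set.finite_range fun p => ‖v p‖).bddAbove
  exact Integrable.of_bound ((Measurable.of_discrete (f := v)).comp
    (J.measurable_stoppedPath R M k)).aestronglyMeasurable C
    (Filter.Eventually.of_forall fun ω => hC ⟨_, rfl⟩)

open Classical in
/-- The conditional expectation of `v` at the next state of the stopped process. -/
noncomputable def nextExp (v : D.State × Z → ℝ) (k : ℕ)
    (ω : ℕ → A × EuclideanSpace ℝ (Fin m)) : ℝ :=
  if J.stoppedPath R M ω k ∈ stopped D M then v (J.stoppedPath R M ω k)
  else ∑ p, J.successorDist H R M (J.stoppedPath R M ω k).2 (σ (J.stoppedPath R M ω k))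
    (ω k).2 p * v p

/-- The tower property, with conditioning on the path up to time `k`. -/
theorem integral_stoppedPath_succ (v : D.State × Z → ℝ) (k : ℕ) :
    Integrable (J.nextExp R M H σ v k) (H.pathLaw (Discretization.refine J R M σ) s₀) ∧
    ∫ ω, v (J.stoppedPath R M ω (k + 1)) ∂H.pathLaw (Discretization.refine J R M σ) s₀ =
      ∫ ω, J.nextExp R M H σ v k ω ∂H.pathLaw (Discretization.refine J R M σ) s₀ := by
  classical
  let _ : MeasurableSpace (D.State × Z) := ⊤
  obtain ⟨Y, hY, hYω⟩ := J.exists_stoppedPath_eq R M k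
  obtain ⟨C, hC⟩ := (Set.finite_range fun p => ‖v p‖).bddAbove
  let f : (D.State × Z) × (A × EuclideanSpace ℝ (Fin m)) → ℝ := fun p =>
    v (if p.1 ∈ stopped D M then p.1 else J.productState R M p.1.2 p.2)
  have hf : Measurable f := by
    refine (Measurable.of_discrete (f := v)).comp
      (measurable_from_prod_countable_right fun p => ?_)
    by_cases hp : p ∈ stopped D M
    · simp [hp]
    · simpa [hp] using J.measurable_productState R M p.2
  have key := H.integral_pathLaw_succ (Discretization.refine J R M σ) s₀ k hY hf
    (C := C) fun p => hC ⟨_, rfl⟩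
  have hinner : ∀ ω : ℕ → A × EuclideanSpace ℝ (Fin m),
      ∫ y, f (Y (Preorder.frestrictLe k ω),
        ((Discretization.refine J R M σ).mode k (Preorder.frestrictLe k ω), y))
        ∂H.transition ((Discretization.refine J R M σ).mode k (Preorder.frestrictLe k ω),
          (ω k).2) = J.nextExp R M H σ v k ω := by
    intro ω
    rw [← hYω, mode_refine, nextExp]
    by_cases hs : J.stoppedPath R M ω k ∈ stopped D M
    · simp [f, hs]
    -- Before stopping, the stopped path is the true product state, so the refined strategy plays
    -- `σ` at it.
    · have heq : J.stoppedPath R M ω k = (J.toFun (ω k), J.dfaState R M ω k) := by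
        rcases J.stoppedPath_cases R M ω k with ⟨h, -⟩ | ⟨h, -⟩ | ⟨-, -, -, h⟩
        · exact absurd (Or.inr h) hs
        · exact absurd (Or.inl h) hs
        · exact h
      simp only [f, if_neg hs]
      rw [J.integral_productState, ← heq]
  have houter : ∀ ω : ℕ → A × EuclideanSpace ℝ (Fin m),
      f (Y (Preorder.frestrictLe k ω), ω (k + 1)) = v (J.stoppedPath R M ω (k + 1)) := by
    intro ω
    rw [← hYω, stoppedPath]
  simp only [hinner, houter] at key
  exact key

end Discretization.Quantizer

/-! ### Bounds on the satisfaction probability -/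

namespace Discretization.Quantizer

variable {A Υ Z : Type*} {m r : ℕ} {X : Set (EuclideanSpace ℝ (Fin m))} [MeasurableSpace A]
  {D : Discretization A X} (J : D.Quantizer) {R : Υ → Set (EuclideanSpace ℝ (Fin m))}
  {M : DFA (Set Υ) Z} [DiscreteMeasurableSpace A] [Fintype A] {H : SHS A Υ m r}

/-- Almost surely concrete and abstract labels agree at all times, so the automaton run on abstract
labels detects exactly the good prefixes of the concrete trace. -/
theorem satProb_eq (hH : ∀ a, (H.G a * H.cov * (H.G a).transpose).PosDef)
    (hRX : ∀ p, R p ⊆ X) (hL : ∀ p a x, p ∈ H.label (a, x) ↔ x ∈ R p)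
    {φ : Spec Υ} (hM : ∀ w, w ∈ M.accepts ↔ φ.GoodPrefix w) (hD : D.Respects R)
    (σ : SwitchingStrategy A m) {s₀ : A × EuclideanSpace ℝ (Fin m)}
    (hs₀ : H.label s₀ = D.label R (J.toFun s₀)) :
    H.satProb φ s₀ X σ =
      (H.pathLaw σ s₀).real (⋃ k, {ω | J.stoppedPath R M ω k ∈ D.accepting M}) := by
  have hlabel : ∀ᵐ ω ∂H.pathLaw σ s₀, ∀ i, H.label (ω i) = D.label R (J.toFun (ω i)) := by
    rw [ae_all_iff]
    intro i
    cases i with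
    | zero =>
      filter_upwards [H.ae_pathLaw_zero σ s₀] with ω hω
      rw [hω, hs₀]
    | succ i =>
      filter_upwards [H.ae_pathLaw_succ σ s₀ hH D.volume_overlap i] with ω hω
      exact J.label_eq hRX hL hD hω
  refine congrArg ENNReal.toReal (measure_congr ?_)
  filter_upwards [hlabel] with ω hω
  have htrace : ∀ k, φ.GoodPrefix (H.trace ω k) ↔ J.dfaState R M ω k ∈ M.accept := by
    intro k
    rw [← hM, DFA.mem_accepts, SHS.trace, dfaState]
    simp only [hω]
  refine propext ?_
  change (∃ k, (∀ i ≤ k, (ω i).2 ∈ X) ∧ φ.GoodPrefix (H.trace ω k)) ↔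
    ω ∈ ⋃ k, {ω | J.stoppedPath R M ω k ∈ D.accepting M}
  simp only [Set.mem_iUnion, Set.mem_ofPred_eq, htrace, stoppedPath_mem_accepting_iff]
  exact ⟨fun ⟨k, h⟩ => ⟨k, k, le_rfl, h⟩, fun ⟨_, j, _, h⟩ => ⟨j, h⟩⟩

variable [Fintype Z] {σ : D.State × Z → A}

theorem integral_indicator_stoppedPath (S : Set (D.State × Z)) (k : ℕ)
    (s₀ : A × EuclideanSpace ℝ (Fin m)) :
    ∫ ω, S.indicator (fun _ => (1 : ℝ)) (J.stoppedPath R M ω k)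
      ∂H.pathLaw (Discretization.refine J R M σ) s₀ =
      (H.pathLaw (Discretization.refine J R M σ) s₀).real {ω | J.stoppedPath R M ω k ∈ S} := by
  rw [← integral_indicator_one (J.measurableSet_stoppedPath_mem S k)]
  rfl

/-- Outside the stopped states, the law of the next state is feasible. -/
theorem successorDist_stoppedPath_mem_feasible
    (hH : ∀ a, (H.G a * H.cov * (H.G a).transpose).PosDef) (hX : MeasurableSet X)
    {ω : ℕ → A × EuclideanSpace ℝ (Fin m)} {k : ℕ}
    (hs : J.stoppedPath R M ω k ∉ stopped D M) (b : A) :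
    J.successorDist H R M (J.stoppedPath R M ω k).2 b (ω k).2 ∈
      ((D.abstraction H).prod (D.label R) M).feasible (J.stoppedPath R M ω k) b := by
  obtain ⟨c, hx, hc⟩ := J.exists_cell_of_notMem_stopped hs
  have h := J.successorDist_mem_feasible H hH hX R M c (J.stoppedPath R M ω k).2 b hx
  rwa [← hc] at h

/-- Along the stopped process the upper value is a supermartingale that dominates the indicator of
acceptance; then `k → ∞`. -/
theorem pathLaw_accepting_le_upperValue (hH : ∀ a, (H.G a * H.cov * (H.G a).transpose).PosDef)
    (hX : MeasurableSet X) (s₀ : A × EuclideanSpace ℝ (Fin m)) :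
    (H.pathLaw (Discretization.refine J R M σ) s₀).real
        (⋃ k, {ω | J.stoppedPath R M ω k ∈ D.accepting M}) ≤
      ((D.abstraction H).prod (D.label R) M).upperValue (D.accepting M) σ
        (J.productState R M M.start s₀) := by
  set μ := H.pathLaw (Discretization.refine J R M σ) s₀
  set w := ((D.abstraction H).prod (D.label R) M).upperValue (D.accepting M) σ
  have hw := ((D.abstraction H).prod (D.label R) M).upperValue_mem_Icc (D.accepting M) σ
  have hstep : ∀ k, ∫ ω, w (J.stoppedPath R M ω k) ∂μ ≤ w (J.productState R M M.start s₀) := by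
    intro k
    induction k with
    | zero => rw [J.integral_stoppedPath_zero]
    | succ k ih =>
      obtain ⟨hint, heq⟩ := J.integral_stoppedPath_succ R M H σ s₀ w k
      rw [heq]
      refine le_trans (integral_mono hint (J.integrable_stoppedPath R M H σ s₀ w k)
        fun ω => ?_) ih
      simp only [nextExp]
      split_ifs with hs
      · exact le_rfl
      · exact IMDP.expectation_upperValue_le (fun h => hs (Or.inr h))
          (J.successorDist_stoppedPath_mem_feasible hH hX hs _)
  have hlim : Filter.Tendsto
      (fun k => μ.real {ω | J.stoppedPath R M ω k ∈ D.accepting M}) Filter.atTop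
      (nhds (μ.real (⋃ k, {ω | J.stoppedPath R M ω k ∈ D.accepting M}))) :=
    (ENNReal.tendsto_toReal (measure_ne_top _ _)).comp
      (tendsto_measure_iUnion_atTop J.monotone_accepting)
  refine le_of_tendsto' hlim fun k => le_trans ?_ (hstep k)
  rw [← J.integral_indicator_stoppedPath]
  refine integral_mono (J.integrable_stoppedPath R M H σ s₀ _ k)
    (J.integrable_stoppedPath R M H σ s₀ w k) fun ω => ?_
  by_cases h : J.stoppedPath R M ω k ∈ D.accepting M
  · simp only [Set.indicator_of_mem h]
    exact IMDP.one_le_upperValue _ _ _ h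
  · simp only [Set.indicator_of_notMem h]
    exact (hw _).1

theorem lowerValue_none (T : Set (D.State × Z)) (hT : ∀ z, (none, z) ∉ T) (z : Z) :
    ((D.abstraction H).prod (D.label R) M).lowerValue T (none, z) = 0 := by
  refine IMDP.lowerValue_eq_zero (S := {p : D.State × Z | p.1 = none}) ?_ ?_
    (rfl : (none : D.State) = none)
  · rintro ⟨_, z⟩ rfl
    exact hT z
  · rintro ⟨_, z⟩ rfl a ⟨q, z'⟩ hq
    rcases q with _ | q
    · exact absurd rfl hq
    · simp only [IMDP.prod, abstraction, ite_self]
      exact le_rfl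

/-- The probability that the process is not stopped decays geometrically. -/
theorem pathLaw_notMem_stopped_le {ρ : ℝ} (hρ0 : 0 ≤ ρ) (hX : MeasurableSet X)
    (hρ : ∀ a, ∀ x ∈ X, (H.transition (a, x)).real X ≤ ρ) (s₀ : A × EuclideanSpace ℝ (Fin m))
    (k : ℕ) :
    (H.pathLaw (Discretization.refine J R M σ) s₀).real
      {ω | J.stoppedPath R M ω k ∈ (stopped D M)ᶜ} ≤ ρ ^ k := by
  induction k with
  | zero => simp
  | succ k ih =>
    set v : D.State × Z → ℝ := (stopped D M)ᶜ.indicator fun _ => 1 with hv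
    obtain ⟨hint, heq⟩ := J.integral_stoppedPath_succ R M H σ s₀ v k
    rw [← J.integral_indicator_stoppedPath] at ih ⊢
    rw [heq, pow_succ']
    refine le_trans ?_ (mul_le_mul_of_nonneg_left ih hρ0)
    rw [← integral_const_mul]
    refine integral_mono hint ((J.integrable_stoppedPath R M H σ s₀ v k).const_mul ρ) fun ω => ?_
    simp only [nextExp]
    split_ifs with hs
    · have h0 : v (J.stoppedPath R M ω k) = 0 :=
        Set.indicator_of_notMem (Set.notMem_compl_iff.2 hs) _
      rw [← hv, h0, mul_zero]
    · have h1 : v (J.stoppedPath R M ω k) = 1 := Set.indicator_of_mem hs _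
      rw [← hv, h1, mul_one, ← J.integral_productState]
      obtain ⟨c, hx, -⟩ := J.exists_cell_of_notMem_stopped hs
      -- Remaining unstopped requires the next position to lie in `X`.
      refine le_trans ?_ (hρ (σ (J.stoppedPath R M ω k)) _ (D.cell_subset c.1 c.2 hx))
      rw [← integral_indicator_one hX]
      refine integral_mono_of_nonneg (Filter.Eventually.of_forall fun y =>
        Set.indicator_nonneg (fun _ _ => zero_le_one) _)
        ((integrable_const (1 : ℝ)).indicator hX) (Filter.Eventually.of_forall fun y => ?_)
      by_cases hy : y ∈ X
      · simp only [Set.indicator_of_mem hy]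
        exact Set.indicator_le_self' (fun _ _ => zero_le_one) _
      · have hst : J.productState R M (J.stoppedPath R M ω k).2
            (σ (J.stoppedPath R M ω k), y) ∈ stopped D M := Or.inl ((J.eq_none_iff _).2 hy)
        simp only [hv, Set.indicator_of_notMem hy]
        exact (Set.indicator_of_notMem (Set.notMem_compl_iff.2 hst) _).le

/-- The lower value is a submartingale along the stopped process; at time `k` it is 0 if the path
has left `X` and at most 1 otherwise. -/
theorem lowerValue_le_add (hH : ∀ a, (H.G a * H.cov * (H.G a).transpose).PosDef)
    (hX : MeasurableSet X)
    (hσ : ((D.abstraction H).prod (D.label R) M).IsOptimal (D.accepting M) σ)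
    (s₀ : A × EuclideanSpace ℝ (Fin m)) (k : ℕ) :
    ((D.abstraction H).prod (D.label R) M).lowerValue (D.accepting M)
        (J.productState R M M.start s₀) ≤
      (H.pathLaw (Discretization.refine J R M σ) s₀).real
        {ω | J.stoppedPath R M ω k ∈ D.accepting M} +
      (H.pathLaw (Discretization.refine J R M σ) s₀).real
        {ω | J.stoppedPath R M ω k ∈ (stopped D M)ᶜ} := by
  set μ := H.pathLaw (Discretization.refine J R M σ) s₀
  set v := ((D.abstraction H).prod (D.label R) M).lowerValue (D.accepting M) with hv
  have hvI := ((D.abstraction H).prod (D.label R) M).lowerValue_mem_Icc (D.accepting M)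
  have hstep : ∀ k, v (J.productState R M M.start s₀) ≤ ∫ ω, v (J.stoppedPath R M ω k) ∂μ := by
    intro k
    induction k with
    | zero => rw [J.integral_stoppedPath_zero]
    | succ k ih =>
      obtain ⟨hint, heq⟩ := J.integral_stoppedPath_succ R M H σ s₀ v k
      rw [heq]
      refine ih.trans (integral_mono (J.integrable_stoppedPath R M H σ s₀ v k) hint fun ω => ?_)
      simp only [nextExp]
      split_ifs with hs
      · exact le_rfl
      · exact IMDP.lowerValue_le_expectation hσ (fun h => hs (Or.inr h))
          (fun a => ⟨_, J.successorDist_stoppedPath_mem_feasible hH hX hs a⟩)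
          (J.successorDist_stoppedPath_mem_feasible hH hX hs _)
  refine (hstep k).trans ?_
  have hi := fun S : Set (D.State × Z) =>
    J.integrable_stoppedPath R M H σ s₀ (S.indicator fun _ => (1 : ℝ)) k
  rw [← J.integral_indicator_stoppedPath, ← J.integral_indicator_stoppedPath,
    ← integral_add (hi _) (hi _)]
  refine integral_mono (J.integrable_stoppedPath R M H σ s₀ v k) ((hi _).add (hi _)) fun ω => ?_
  have hnn : ∀ S : Set (D.State × Z), 0 ≤ S.indicator (fun _ => (1 : ℝ)) (J.stoppedPath R M ω k) :=
    fun S => Set.indicator_nonneg (fun _ _ => zero_le_one) _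
  change v (J.stoppedPath R M ω k) ≤ _ + _
  by_cases hs : J.stoppedPath R M ω k ∈ stopped D M
  · rcases hs with h | h
    · have h0 : v (J.stoppedPath R M ω k) = 0 := by
        rw [← Prod.mk.eta (p := J.stoppedPath R M ω k), h]
        exact lowerValue_none _ (fun z h => h.1 rfl) _
      rw [h0]
      exact add_nonneg (hnn _) (hnn _)
    · rw [Set.indicator_of_mem h]
      exact (hvI _).2.trans (le_add_of_nonneg_right (hnn _))
  · rw [Set.indicator_of_mem (Set.mem_compl hs)]
    exact (hvI _).2.trans (le_add_of_nonneg_left (hnn _))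

/-- In dimension `0` every cell is the whole space, so all paths have the same trace. -/
theorem lowerValue_le_of_subsingleton [Subsingleton (EuclideanSpace ℝ (Fin m))]
    (s₀ : A × EuclideanSpace ℝ (Fin m)) (σ : SwitchingStrategy A m) :
    ((D.abstraction H).prod (D.label R) M).lowerValue (D.accepting M)
        (J.productState R M M.start s₀) ≤
      (H.pathLaw σ s₀).real (⋃ k, {ω | J.stoppedPath R M ω k ∈ D.accepting M}) := by
  by_cases hs₀ : s₀.2 ∈ X
  swap
  · rw [productState, (J.eq_none_iff s₀).2 hs₀, lowerValue_none _ fun z h => h.1 rfl]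
    exact measureReal_nonneg
  have hX : ∀ x, x ∈ X := fun x => Subsingleton.elim s₀.2 x ▸ hs₀
  set ℓ : Set Υ := {p | Set.univ ⊆ R p} with hℓ
  have hlab : ∀ c : Σ a : A, Fin (D.num a), D.label R (some c) = ℓ := by
    intro c
    have hc : D.cell c.1 c.2 = Set.univ :=
      Subsingleton.eq_univ_of_nonempty
        ((D.isPolytope c.1 c.2).interior_nonempty.mono interior_subset)
    simp only [label, hc, hℓ]
  have hlabJ : ∀ s, D.label R (J.toFun s) = ℓ := by
    intro s
    obtain ⟨i, hi, -⟩ := J.mem_cell s.1 s.2 (hX _)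
    rw [hi, hlab]
  set g : Z → Z := fun z => M.step z ℓ
  -- The automaton follows the orbit of `g`. Either it accepts on every path, or the orbit together
  -- with the exit state is a closed set without accepting states.
  by_cases hacc : ∃ j, g^[j] (g M.start) ∈ M.accept
  · obtain ⟨j, hj⟩ := hacc
    have hstate : ∀ ω k, J.dfaState R M ω k = g^[k] (g M.start) := by
      intro ω k
      induction k with
      | zero => rw [dfaState_zero, productState, hlabJ]; rfl
      | succ k ih => rw [dfaState_succ, productState, hlabJ, ih, Function.iterate_succ_apply']
    have huniv : ⋃ k, {ω | J.stoppedPath R M ω k ∈ D.accepting M} = Set.univ := by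
      refine Set.eq_univ_of_forall fun ω => Set.mem_iUnion.2 ⟨j, ?_⟩
      rw [Set.mem_ofPred_eq, stoppedPath_mem_accepting_iff]
      exact ⟨j, le_rfl, fun i _ => hX _, by rwa [hstate]⟩
    rw [huniv, probReal_univ]
    exact (IMDP.lowerValue_mem_Icc _ _ _).2
  · push Not at hacc
    have h0 : ((D.abstraction H).prod (D.label R) M).lowerValue (D.accepting M)
        (J.productState R M M.start s₀) = 0 := by
      refine IMDP.lowerValue_eq_zero
        (S := {p | p.1 = none ∨ ∃ j, p.2 = g^[j] (g M.start)}) ?_ ?_ ?_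
      · rintro ⟨q, z⟩ (h | ⟨j, h⟩) ⟨hq, hz⟩
        · exact hq h
        · exact hacc j (h ▸ hz)
      · rintro ⟨q, z⟩ hqz a ⟨_ | d, z'⟩ hd
        · exact absurd (Or.inl rfl) hd
        · rcases q with _ | c
          · simp only [IMDP.prod, abstraction, ite_self]
            exact le_rfl
          · obtain ⟨j, hj⟩ := hqz.resolve_left (by simp)
            have hne : z' ≠ M.step z (D.label R (some d)) := by
              rintro rfl
              refine hd (Or.inr ⟨j + 1, ?_⟩)
              rw [Function.iterate_succ_apply', hlab]
              exact congrArg g hj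
            simp only [IMDP.prod, if_neg hne]
            exact le_rfl
      · exact Or.inr ⟨0, by rw [productState, hlabJ]; rfl⟩
    rw [h0]
    exact measureReal_nonneg

theorem lowerValue_le_pathLaw_accepting (hH : ∀ a, (H.G a * H.cov * (H.G a).transpose).PosDef)
    (hX : IsCompact X)
    (hσ : ((D.abstraction H).prod (D.label R) M).IsOptimal (D.accepting M) σ)
    (s₀ : A × EuclideanSpace ℝ (Fin m)) :
    ((D.abstraction H).prod (D.label R) M).lowerValue (D.accepting M)
        (J.productState R M M.start s₀) ≤
      (H.pathLaw (Discretization.refine J R M σ) s₀).real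
        (⋃ k, {ω | J.stoppedPath R M ω k ∈ D.accepting M}) := by
  -- Escape from `X` needs positive dimension: a one-point space can equal `X` and is then never
  -- left.
  rcases Nat.eq_zero_or_pos m with rfl | hm
  · exact J.lowerValue_le_of_subsingleton s₀ _
  have : NeZero m := ⟨hm.ne'⟩
  obtain ⟨ρ, hρ0, hρ1, hρ⟩ := H.exists_transition_le_of_isCompact hH hX
  have hlim : Filter.Tendsto (fun k => (H.pathLaw (Discretization.refine J R M σ) s₀).real
      (⋃ k, {ω | J.stoppedPath R M ω k ∈ D.accepting M}) + ρ ^ k) Filter.atTop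
      (nhds ((H.pathLaw (Discretization.refine J R M σ) s₀).real
        (⋃ k, {ω | J.stoppedPath R M ω k ∈ D.accepting M}) + 0)) :=
    (tendsto_pow_atTop_nhds_zero_of_lt_one hρ0 hρ1).const_add _
  rw [add_zero] at hlim
  refine ge_of_tendsto' hlim fun k => (J.lowerValue_le_add hH hX.measurableSet hσ s₀ k).trans
    (add_le_add (measureReal_mono ?_) (J.pathLaw_notMem_stopped_le hρ0 hX.measurableSet hρ s₀ k))
  exact Set.subset_iUnion (fun k => {ω | J.stoppedPath R M ω k ∈ D.accepting M}) k

end Discretization.Quantizer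

theorem mainTheorem1 {A Υ Z : Type*} [Fintype A] [Nonempty A]
    [MeasurableSpace A] [DiscreteMeasurableSpace A] [Fintype Υ] [Fintype Z] {m r : ℕ}
    (H : SHS A Υ m r) (hH : ∀ a, (H.G a * H.cov * (H.G a).transpose).PosDef)
    (X : Set (EuclideanSpace ℝ (Fin m))) (hX : IsCompact X)
    (R : Υ → Set (EuclideanSpace ℝ (Fin m)))
    (hR : ∀ p, IsClosed (R p)) (hRX : ∀ p, R p ⊆ X)
    (hL : ∀ p a x, p ∈ H.label (a, x) ↔ x ∈ R p)
    (φ : Spec Υ) (M : DFA (Set Υ) Z) (hM : ∀ w, w ∈ M.accepts ↔ φ.GoodPrefix w)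
    (D : Discretization A X) (hD : D.Respects R) (J : D.Quantizer)
    (σ : D.State × Z → A)
    (hσ : ((D.abstraction H).prod (D.label R) M).IsOptimal (D.accepting M) σ) :
    (∀ s₀ : A × EuclideanSpace ℝ (Fin m), H.label s₀ = D.label R (J.toFun s₀) →
      H.satProb φ s₀ X (Discretization.refine J R M σ) ∈ Set.Icc
        (((D.abstraction H).prod (D.label R) M).lowerValue (D.accepting M)
          (J.toFun s₀, M.step M.start (D.label R (J.toFun s₀))))
        (((D.abstraction H).prod (D.label R) M).upperValue (D.accepting M) σ
          (J.toFun s₀, M.step M.start (D.label R (J.toFun s₀))))) ∧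
    (∀ (a : A) (i : Fin (D.num a)), ∀ x ∈ interior (D.cell a i),
      H.satProb φ (a, x) X (Discretization.refine J R M σ) ∈ Set.Icc
        (((D.abstraction H).prod (D.label R) M).lowerValue (D.accepting M)
          (some ⟨a, i⟩, M.step M.start (D.label R (some ⟨a, i⟩))))
        (((D.abstraction H).prod (D.label R) M).upperValue (D.accepting M) σ
          (some ⟨a, i⟩, M.step M.start (D.label R (some ⟨a, i⟩))))) := by
  have main : ∀ s₀ : A × EuclideanSpace ℝ (Fin m), H.label s₀ = D.label R (J.toFun s₀) →
      H.satProb φ s₀ X (Discretization.refine J R M σ) ∈ Set.Icc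
        (((D.abstraction H).prod (D.label R) M).lowerValue (D.accepting M)
          (J.toFun s₀, M.step M.start (D.label R (J.toFun s₀))))
        (((D.abstraction H).prod (D.label R) M).upperValue (D.accepting M) σ
          (J.toFun s₀, M.step M.start (D.label R (J.toFun s₀)))) := by
    intro s₀ hs₀
    rw [J.satProb_eq hH hRX hL hM hD _ hs₀]
    exact ⟨J.lowerValue_le_pathLaw_accepting hH hX hσ s₀,
      J.pathLaw_accepting_le_upperValue hH hX.measurableSet s₀⟩
  refine ⟨main, fun a i x hx => ?_⟩
  have hJ : J.toFun (a, x) = some ⟨a, i⟩ := by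
    obtain ⟨j, hj, hxj⟩ := J.mem_cell a x (D.cell_subset a i (interior_subset hx))
    rw [hj, D.eq_of_mem_interior hx hxj]
  -- An interior point lies in a single cell, hence off the overlaps, so the first part applies.
  have hlabel : H.label (a, x) = D.label R (J.toFun (a, x)) := by
    refine J.label_eq hRX hL hD ?_
    rintro ⟨j, j', hne, hj, hj'⟩
    exact hne ((D.eq_of_mem_interior hx hj).trans (D.eq_of_mem_interior hx hj').symm)
  have h := main (a, x) hlabel
  rwa [hJ] at h
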